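/- Let $\mathcal{O}$ be a complete discrete valuation ring whose residue field is algebraically closed of characteristic $2$ and whose field of fractions $K$ has characteristic $0$. Let $P$ be a finite abelian $2$-group, let $n\ge 1$, and let $G_n=(C_{2^n}\times C_{2^n})\rtimes C_3$, where, for generators $a,b$ of the two cyclic factors, a generator of $C_3$ permutes $a\mapsto b\mapsto (ab)^{-1}\mapsto a$. Assume that $K$ contains all $|P\times G_n|$-th roots of unity, and let $\chi_1,\chi_2,\chi_3$ be the three linear characters of $G_n$ over $K$ inflated from $C_3$: for a primitive cube root of unity $\omega\in K$, the character $\chi_i$ sends a generator of $C_3$ to $\omega^{i-1}$. For a finite group $G$, write $\mathrm{Irr}(G)$ for the set of irreducible characters of $G$ over $K$. A permutation $I$ of $\mathrm{Irr}(G)$ is induced by an $\mathcal{O}$-linear Morita auto-equivalence $F$ of $\mathcal{O}G$ if, whenever an $\mathcal{O}$-free $\mathcal{O}G$-module $V$ of finite rank has character $\chi\in\mathrm{Irr}(G)$, the module $F(V)$ is $\mathcal{O}$-free of finite rank with character $I(\chi)$. A perfect self-isometry of $\mathcal{O}G$ is an isometry $J:\mathbb{Z}\,\mathrm{Irr}(G)\to\mathbb{Z}\,\mathrm{Irr}(G)$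 (for the usual inner product) whose $K$-linear extension to $K\,\mathrm{Irr}(G)$ maps the $\mathcal{O}$-module of $\mathcal{O}$-valued functions in $K\,\mathrm{Irr}(G)$ bijectively onto itself, and likewise the $\mathcal{O}$-submodule of those functions which moreover vanish outside the elements of odd order. Let $I$ be a permutation of $\mathrm{Irr}(P\times G_n)$ induced by a Morita auto-equivalence of $\mathcal{O}(P\times G_n)$. Then there exist $\sigma\in S_3$ and a perfect self-isometry $J$ of $\mathcal{O}P$ with all signs positive (that is, $J(\theta)\in\mathrm{Irr}(P)$ for every $\theta\in\mathrm{Irr}(P)$) such that $$I(\theta\otimes\chi_i)=J(\theta)\otimes\chi_{\sigma(i)}\qquad\text{for all }\theta\in\mathrm{Irr}(P)\text{ and }1\le i\le 3.$$ -/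

import Mathlib

open scoped ModuleCat.Algebra

namespace PicardBlocks

noncomputable section

/-! ### Ordinary characters -/

/-- `Irr(G)` with respect to the field `K`: the characters `G → K` of the irreducible
finite-dimensional representations of `G` over `K`. -/
def Irr (K : Type*) [Field K] (G : Type*) [Group G] : Set (G → K) :=
  {χ | ∃ (d : ℕ) (ρ : Representation K G (Fin d → K)), ρ.IsIrreducible ∧ ρ.character = χ}

/-- The outer tensor product `θ ⊗ ψ` of functions on two groups. -/
def tensorFun {K : Type*} [Field K] {P H : Type*} (θ : P → K) (ψ : H → K) : P × H → K :=
  fun x => θ x.1 * ψ x.2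

/-- The twist of the inflation of a representation of `P` by a linear character of `H`. -/
def twistRep {K : Type*} [Field K] {P H : Type*} [Group P] [Group H] {V : Type*}
    [AddCommGroup V] [Module K V] (ρ : Representation K P V) (l : H →* K) :
    Representation K (P × H) V where
  toFun x := l x.2 • ρ x.1
  map_one' := by simp
  map_mul' x y := by
    ext v
    simp [smul_smul, mul_comm]

theorem twistRep_isIrreducible {K : Type*} [Field K] {P H : Type*} [Group P] [Group H]
    {V : Type*} [AddCommGroup V] [Module K V] (ρ : Representation K P V) (l : H →* K)
    (h : ρ.IsIrreducible) : (twistRep ρ l).IsIrreducible := by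
  let e : Subrepresentation ρ ≃o Subrepresentation (twistRep ρ l) :=
    { toFun := fun W => ⟨W.toSubmodule, fun x v hv =>
        W.toSubmodule.smul_mem _ (W.apply_mem_toSubmodule x.1 hv)⟩
      invFun := fun W => ⟨W.toSubmodule, fun x v hv => by
        have := W.apply_mem_toSubmodule (x, 1) hv
        simpa [twistRep] using this⟩
      left_inv := fun _ => rfl
      right_inv := fun _ => rfl
      map_rel_iff' := Iff.rfl }
  exact e.isSimpleOrder_iff.mp h

/-- If `θ ∈ Irr(P)` and `l` is a linear character of `H`, then `θ ⊗ l ∈ Irr(P × H)`. -/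
theorem tensorFun_mem_Irr {K : Type*} [Field K] {P H : Type*} [Group P] [Group H]
    {θ : P → K} (hθ : θ ∈ Irr K P) (l : H →* K) : tensorFun θ l ∈ Irr K (P × H) := by
  obtain ⟨d, ρ, hρ, rfl⟩ := hθ
  refine ⟨d, twistRep ρ l, twistRep_isIrreducible ρ l hρ, ?_⟩
  ext x
  simp [Representation.character, twistRep, tensorFun, mul_comm]

/-- `θ ⊗ l` as an element of `Irr(P × H)`, for `θ ∈ Irr(P)` and a linear character `l` of `H`. -/
def Irr.tensor {K : Type*} [Field K] {P H : Type*} [Group P] [Group H]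
    (θ : Irr K P) (l : H →* K) : Irr K (P × H) :=
  ⟨tensorFun θ.1 l, tensorFun_mem_Irr θ.2 l⟩

/-! ### The groups `G_n` -/

/-- `C_{2^n} × C_{2^n}`, with generators `a = (1, 0)` and `b = (0, 1)` in additive notation. -/
abbrev HomocyclicGroup (n : ℕ) : Type := Multiplicative (ZMod (2 ^ n) × ZMod (2 ^ n))

/-- The automorphism `a ↦ b ↦ (ab)⁻¹ ↦ a` of `C_{2^n} × C_{2^n}`. -/
def cycleAut (n : ℕ) : MulAut (HomocyclicGroup n) :=
  AddEquiv.toMultiplicative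
    { toFun := fun x => (-x.2, x.1 - x.2)
      invFun := fun x => (x.2 - x.1, -x.1)
      left_inv := fun x => by ext <;> simp
      right_inv := fun x => by ext <;> simp
      map_add' := fun x y => by
        ext
        · simp [add_comm]
        · simp only [Prod.fst_add, Prod.snd_add]
          ring }

theorem cycleAut_pow_three (n : ℕ) : cycleAut n ^ 3 = 1 := by
  have key : ∀ x : HomocyclicGroup n, cycleAut n (cycleAut n (cycleAut n x)) = x := fun x => by
    apply Multiplicative.toAdd.injective
    change ((-(-x.toAdd.2 - (x.toAdd.1 - x.toAdd.2)),
      -(x.toAdd.1 - x.toAdd.2) - (-x.toAdd.2 - (x.toAdd.1 - x.toAdd.2))) :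
        ZMod (2 ^ n) × ZMod (2 ^ n)) = x.toAdd
    ext
    · simp
    · simp only
      ring
  exact MulEquiv.ext key

/-- The action of `C_3` on `C_{2^n} × C_{2^n}` permuting `a`, `b`, `(ab)⁻¹` cyclically. -/
def cycleAction (n : ℕ) : Multiplicative (ZMod 3) →* MulAut (HomocyclicGroup n) where
  toFun c := cycleAut n ^ (c.toAdd.val)
  map_one' := by simp
  map_mul' c d := by
    rw [toAdd_mul, ZMod.val_add, ← pow_add]
    exact (pow_eq_pow_mod _ (cycleAut_pow_three n)).symm

/-- `G_n = (C_{2^n} × C_{2^n}) ⋊ C_3`. -/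
abbrev Gn (n : ℕ) : Type :=
  HomocyclicGroup n ⋊[cycleAction n] Multiplicative (ZMod 3)

/-- The three linear characters of `G_n`, inflated from `C_3`: for a cube root of unity `ω`, the
`i`-th one (`i = 0, 1, 2`) sends a generator of `C_3` to `ω ^ i`. -/
def linChar {K : Type*} [Field K] {ω : K} (hω : IsPrimitiveRoot ω 3) (n : ℕ) (i : Fin 3) :
    Gn n →* K where
  toFun g := (ω ^ (i : ℕ)) ^ (g.right.toAdd.val)
  map_one' := by simp
  map_mul' g h := by
    have h3 : (ω ^ (i : ℕ)) ^ 3 = 1 := by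
      rw [← pow_mul, mul_comm, pow_mul, hω.pow_eq_one, one_pow]
    rw [SemidirectProduct.mul_right, toAdd_mul, ZMod.val_add, ← pow_add]
    exact (pow_eq_pow_mod _ h3).symm

/-! ### Permutations of `Irr(G)` induced by Morita auto-equivalences of `𝒪G` -/

/-- The `K`-valued character of an `𝒪G`-module `V`: the trace of `g` on `V` over `𝒪`. It is used
for `𝒪G`-lattices only, that is, when `V` is free of finite rank over `𝒪`; it is then the character
of `K ⊗ V`. -/
def latticeChar (O K : Type*) [CommRing O] [Field K] [Algebra O K] {G : Type*} [Group G]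
    (V : ModuleCat (MonoidAlgebra O G)) : G → K :=
  fun g => algebraMap O K
    (LinearMap.trace O V (Algebra.lsmul O O V (MonoidAlgebra.of O G g)))

/-- The permutation `I` of `Irr(G)` is induced by the (`𝒪`-linear) Morita auto-equivalence `e` of
`𝒪G`: whenever an `𝒪G`-lattice `V` has character `χ ∈ Irr(G)`, its image under the equivalence is
an `𝒪G`-lattice with character `I χ`. -/
def IsInducedBy {O K : Type*} [CommRing O] [Field K] [Algebra O K] {G : Type*} [Group G]
    (I : Equiv.Perm (Irr K G))
    (e : MoritaEquivalence O (MonoidAlgebra O G) (MonoidAlgebra O G)) : Prop :=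
  ∀ (V : ModuleCat (MonoidAlgebra O G)) (χ : Irr K G),
    Module.Finite O V → Module.Free O V → latticeChar O K V = χ →
      Module.Finite O (e.eqv.functor.obj V) ∧ Module.Free O (e.eqv.functor.obj V) ∧
        latticeChar O K (e.eqv.functor.obj V) = I χ

/-! ### Perfect self-isometries of `𝒪G` -/

/-- `ℤ Irr(G)`, the group of generalized characters. -/
def ZIrr (K : Type*) [Field K] (G : Type*) [Group G] : AddSubgroup (G → K) :=
  AddSubgroup.closure (Irr K G)

/-- The usual inner product `⟨α, β⟩ = |G|⁻¹ ∑_g α(g) β(g⁻¹)` of class functions. -/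
def charInner {K : Type*} [Field K] {G : Type*} [Group G] [Fintype G] (α β : G → K) : K :=
  (Fintype.card G : K)⁻¹ * ∑ g, α g * β g⁻¹

/-- The `K`-space `CF(G, 𝒪G, K)` of class functions spanned by `Irr(G)`. -/
def CF (K : Type*) [Field K] (G : Type*) [Group G] : Submodule K (G → K) :=
  Submodule.span K (Irr K G)

/-- The `𝒪`-submodule `CF(G, 𝒪G, 𝒪)` of the `𝒪`-valued functions in `CF(G, 𝒪G, K)`. -/
def CFint (O K : Type*) [CommRing O] [Field K] [Algebra O K] (G : Type*) [Group G] :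
    Submodule O (CF K G) where
  carrier := {φ | ∀ g, φ.1 g ∈ (algebraMap O K).range}
  add_mem' {φ ψ} hφ hψ g := by
    change φ.1 g + ψ.1 g ∈ _
    exact add_mem (hφ g) (hψ g)
  zero_mem' _ := zero_mem _
  smul_mem' c φ hφ g := by
    change c • φ.1 g ∈ _
    rw [Algebra.smul_def]
    exact mul_mem ⟨c, rfl⟩ (hφ g)

/-- The `𝒪`-submodule `CF_{p'}(G, 𝒪G, 𝒪)` of those functions in `CF(G, 𝒪G, 𝒪)` that vanish outside
the `p`-regular elements, the elements of order prime to `p`. -/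
def CFreg (O K : Type*) [CommRing O] [Field K] [Algebra O K] (p : ℕ) (G : Type*) [Group G] :
    Submodule O (CF K G) where
  carrier := {φ | φ ∈ CFint O K G ∧ ∀ g : G, ¬ (orderOf g).Coprime p → φ.1 g = 0}
  add_mem' {φ ψ} hφ hψ := ⟨add_mem hφ.1 hψ.1, fun g hg => by
    change φ.1 g + ψ.1 g = 0
    rw [hφ.2 g hg, hψ.2 g hg, add_zero]⟩
  zero_mem' := ⟨zero_mem _, fun _ _ => rfl⟩
  smul_mem' c φ hφ := ⟨Submodule.smul_mem _ c hφ.1, fun g hg => by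
    change c • φ.1 g = 0
    rw [hφ.2 g hg, smul_zero]⟩

/-- `J ∈ Perf(𝒪G)`: `J` is an isometry of `ℤ Irr(G)` whose `K`-linear extension `JK` (unique, since
`Irr(G)` spans `CF K G`) induces bijections of `CF(G, 𝒪G, 𝒪)` and of `CF_{p'}(G, 𝒪G, 𝒪)` onto
themselves. Here `p` is the residue characteristic of `𝒪`. -/
def IsPerfectSelfIsometry (O : Type*) {K : Type*} [CommRing O] [Field K] [Algebra O K] (p : ℕ)
    {G : Type*} [Group G] [Fintype G] (J : ZIrr K G ≃+ ZIrr K G) : Prop :=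
  (∀ α β : ZIrr K G, charInner (J α : G → K) (J β) = charInner (α : G → K) β) ∧
  ∃ JK : CF K G ≃ₗ[K] CF K G,
    (∀ (α : ZIrr K G) (φ : CF K G), (φ : G → K) = α → (JK φ : G → K) = J α) ∧
    Submodule.map (JK.toLinearMap.restrictScalars O) (CFint O K G) = CFint O K G ∧
    Submodule.map (JK.toLinearMap.restrictScalars O) (CFreg O K p G) = CFreg O K p G

/-- The inclusion of `Irr(G)` into `ℤ Irr(G)`. -/
def irrToZIrr {K : Type*} [Field K] {G : Type*} [Group G] (χ : Irr K G) : ZIrr K G :=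
  ⟨χ.1, AddSubgroup.subset_closure χ.2⟩

end

end PicardBlocks

/-!
Every linear character of `P × G_n` has the form `θ ⊗ χ_i`, and its values lie in `𝒪`, so it is
afforded by the lattice `𝒪`. The proof follows these lattices through the equivalence `F`, using two
invariants that `F` preserves.

*Simple modules.* The simple modules of `𝒪[P × G_n]` have dimension one over the residue field and
are inflated from `C_3` (`exists_cubeChar_residue`): the normal Sylow `2`-subgroup has a nonzero
fixed vector, and the resulting fixed space has an eigenvector for `C_3`. As `F` is exact,
`F (V) / π F (V)` is simple when `V` affords `θ ⊗ χ_i`, so `F (V)` has rank one by Nakayama's lemma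
(`exists_linear_image`). Hence `I (θ ⊗ χ_i) = θ' ⊗ χ_k`. Here `k = σ i` does not depend on `θ`,
because for fixed `i` all `θ ⊗ χ_i` have the same reduction.

*The centre.* The centre of `𝒪[P × G_n]` is the ring of natural endomorphisms of the identity functor,
so for each `x ∈ P` there is a central `z` that takes on each lattice `V` as above the scalar by which
`x` acts on `F (V)` (`exists_center_smul_eq`): evaluating `θ ⊗ χ_i` at `z` gives `θ' x`. The conjugacy
classes outside `P × C_{2^n} × C_{2^n}` have length `4 ^ n`, so the values of `θ ⊗ χ_i` and `θ ⊗ χ_j` at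
`z` agree modulo `4` (`four_dvd_lift_sub_lift`), and roots of unity of `2`-power order are separated
modulo `4`. So `θ'` does not depend on `i`, and `J θ = θ'` is well defined.

The same `z` shows that `J` is perfect. With `χ_i` trivial, `(J θ) x` is the value
of `θ` at the image of `z` in `𝒪P`, so the linear extension of `J` maps `𝒪`-valued functions to
`𝒪`-valued functions, and bijectively since it has finite order. The functions that vanish off the
identity are the multiples of the sum of all irreducible characters, which `J` fixes
(`exists_isPerfectSelfIsometry`).
-/

namespace PicardBlocks

/-! ### The centre of a ring and auto-equivalences of its module category -/

section Center

open CategoryTheory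

universe u v w

/-- Multiplication by a central element of `A`, as an endomorphism of the `A`-module `V`. -/
def centralEnd {A : Type u} [Ring A] (z : A) (hz : z ∈ Set.center A) (V : ModuleCat.{v} A) :
    V ⟶ V :=
  ModuleCat.ofHom
    { toFun := fun v => z • v
      map_add' := smul_add z
      map_smul' := fun a v => by
        rw [RingHom.id_apply, ← mul_smul, ← mul_smul, (Set.mem_center_iff.1 hz).comm a] }

theorem centralEnd_naturality {A : Type u} [Ring A] (z : A) (hz : z ∈ Set.center A)
    {V W : ModuleCat.{v} A} (f : V ⟶ W) : f ≫ centralEnd z hz W = centralEnd z hz V ≫ f := by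
  ext v
  exact (f.hom.map_smul z v).symm

/-- A category of modules remembers the centre of the ring, as the endomorphisms of its identity
functor. So every central element `z'` is the image under an auto-equivalence of a central element
`z`, and if `z` acts on `V` as a scalar then `z'` acts on the image of `V` as the same scalar. -/
theorem exists_center_smul_eq {O : Type w} [CommRing O] {A : Type u} [Ring A] [Algebra O A]
    (e : MoritaEquivalence O A A) {z' : A} (hz' : z' ∈ Set.center A) :
    ∃ z ∈ Set.center A, ∀ (V : ModuleCat.{u} A) (c : O), (∀ v : V, z • v = c • v) →
      ∀ m : e.eqv.functor.obj V, z' • m = c • m := by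
  let F := e.eqv.functor
  let η (V : ModuleCat.{u} A) : V ⟶ V := F.preimage (centralEnd z' hz' (F.obj V))
  have nat {V W : ModuleCat.{u} A} (f : V ⟶ W) : f ≫ η W = η V ≫ f := F.map_injective (by
    simp only [F.map_comp, η, F.map_preimage, centralEnd_naturality])
  let orbit (V : ModuleCat.{u} A) (v : V) : ModuleCat.of A A ⟶ V :=
    ModuleCat.ofHom (LinearMap.toSpanSingleton A V v)
  let z : A := (η (ModuleCat.of A A)).hom (1 : A)
  have hη (V : ModuleCat.{u} A) (v : V) : (η V).hom v = z • v := by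
    have h := congrArg (fun f => f.hom (1 : A)) (nat (orbit V v))
    simpa [orbit] using h
  refine ⟨z, ?_, fun V c h m => ?_⟩
  · rw [Semigroup.mem_center_iff]
    intro a
    have h1 := hη (ModuleCat.of A A) a
    have h2 := (η (ModuleCat.of A A)).hom.map_smul a (1 : A)
    simp only [smul_eq_mul, mul_one] at h1 h2
    exact h2.symm.trans h1
  · have h1 : η V = c • 𝟙 V := by
      ext v
      exact (hη V v).trans (h v)
    have h2 : centralEnd z' hz' (F.obj V) = c • 𝟙 (F.obj V) := by
      rw [← F.map_id, ← F.map_smul, ← h1, F.map_preimage]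
    exact congrArg (fun f => f.hom m) h2

end Center

/-! ### Modules of rank one and their reductions -/

section ScalarModule

open CategoryTheory

universe u v w

/-- The ring `B` as an `A`-module through a ring homomorphism `f : A → B`. For `A` a group algebra
and `B` its ring of coefficients this is the module of rank one that affords a linear character.
The universe lift moves it into a prescribed category of modules. -/
noncomputable def scalarModule {A : Type u} {B : Type w} [Ring A] [Ring B] (f : A →+* B) :
    ModuleCat.{max v w} A :=
  (ModuleCat.restrictScalars f).obj (ModuleCat.of B (ULift.{v} B))

variable {O : Type w} [CommRing O] {A : Type u} [Ring A] [Algebra O A]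

/-- The underlying `O`-module of the module afforded by `f : A →ₐ[O] O` is `O`. -/
noncomputable def scalarModuleEquiv (f : A →ₐ[O] O) :
    scalarModule.{u, v, w} (f : A →+* O) ≃ₗ[O] O :=
  { (Equiv.ulift : ULift.{v} O ≃ O) with
    map_add' := fun _ _ => rfl
    map_smul' := fun c b => by
      change f (algebraMap O A c) * _ = c * _
      rw [AlgHom.commutes]
      rfl }

theorem smul_scalarModule (f : A →ₐ[O] O) (a : A) (v : scalarModule.{u, v, w} (f : A →+* O)) :
    a • v = f a • v := by
  change f a • (ULift.up v.down : ULift O) = f (algebraMap O A (f a)) • (ULift.up v.down : ULift O)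
  rw [AlgHom.commutes]
  rfl

variable [IsLocalRing O]

theorem simple_scalarModule_residue (f : A →ₐ[O] O) :
    Simple (scalarModule.{u, v, w} ((IsLocalRing.residue O).comp (f : A →+* O))) := by
  rw [simple_iff_isSimpleModule', isSimpleModule_iff_toSpanSingleton_surjective]
  refine ⟨⟨⟨⟨0⟩, ⟨1⟩, fun h => zero_ne_one (congrArg ULift.down h)⟩⟩, fun m hm b => ?_⟩
  obtain ⟨m⟩ := m
  obtain ⟨b⟩ := b
  have hm' : m ≠ 0 := fun h => hm (by rw [h]; rfl)
  obtain ⟨c, hc⟩ := IsLocalRing.residue_surjective (b / m)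
  refine ⟨algebraMap O A c, ?_⟩
  change ULift.up (IsLocalRing.residue O (f (algebraMap O A c)) * m) = ULift.up b
  rw [AlgHom.commutes, Algebra.algebraMap_self_apply, hc, div_mul_cancel₀ _ hm']

/-- A Morita auto-equivalence is exact, so it preserves reduction modulo a generator `π` of the
maximal ideal: the image of the simple module is the image of the lattice modulo `π`. -/
theorem exists_reduction {A : Type (max w v)} [Ring A] [Algebra O A] (e : MoritaEquivalence O A A)
    {π : O} (hπ : IsLocalRing.maximalIdeal O = Ideal.span {π}) (f : A →ₐ[O] O) :
    ∃ q : e.eqv.functor.obj (scalarModule.{max w v, v, w} (f : A →+* O)) →ₗ[A]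
        e.eqv.functor.obj
          (scalarModule.{max w v, v, w} ((IsLocalRing.residue O).comp (f : A →+* O))),
      Function.Surjective q ∧ ∀ m, q m = 0 → ∃ m', m = π • m' := by
  let V := scalarModule.{max w v, v, w} (f : A →+* O)
  let S := scalarModule.{max w v, v, w} ((IsLocalRing.residue O).comp (f : A →+* O))
  let r : V ⟶ S := ModuleCat.ofHom (X := V) (Y := S)
    { toFun := fun x => ULift.up (IsLocalRing.residue O x.down)
      map_add' := fun x y => congrArg ULift.up (map_add (IsLocalRing.residue O) x.down y.down)
      map_smul' := fun a x => congrArg ULift.up (map_mul (IsLocalRing.residue O) (f a) x.down) }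
  have hr (x : V) : r.hom x = ULift.up (IsLocalRing.residue O x.down) := rfl
  have hπV (x : V) : (π • x : V).down = π * x.down := (scalarModuleEquiv f).map_smul π x
  have hmem (c : O) : IsLocalRing.residue O c = 0 ↔ ∃ d, c = π * d := by
    rw [IsLocalRing.residue_eq_zero_iff, hπ, Ideal.mem_span_singleton]
    rfl
  have hw : (π • 𝟙 V) ≫ r = 0 := by
    ext x
    change ULift.up (IsLocalRing.residue O (π • x : V).down) = ULift.up 0
    rw [(hmem _).2 ⟨_, hπV x⟩]
  let C : ShortComplex (ModuleCat.{max w v} A) := ShortComplex.mk _ _ hw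
  have hC : C.Exact := by
    rw [ShortComplex.moduleCat_exact_iff]
    intro x hx
    obtain ⟨d, hd⟩ := (hmem x.down).1 (congrArg ULift.down hx)
    exact ⟨ULift.up d, ULift.down_injective ((hπV (ULift.up d)).trans hd.symm)⟩
  have hepi : Epi r := by
    rw [ModuleCat.epi_iff_surjective]
    rintro ⟨y⟩
    obtain ⟨c, rfl⟩ := IsLocalRing.residue_surjective y
    exact ⟨ULift.up c, rfl⟩
  have hFC := hC.map e.eqv.functor
  rw [ShortComplex.moduleCat_exact_iff] at hFC
  refine ⟨(e.eqv.functor.map r).hom, (ModuleCat.epi_iff_surjective _).1 inferInstance,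
    fun m hm => ?_⟩
  obtain ⟨m', hm'⟩ := hFC m hm
  refine ⟨m', hm'.symm.trans ?_⟩
  change (e.eqv.functor.map (π • 𝟙 V)).hom m' = _
  rw [e.eqv.functor.map_smul, e.eqv.functor.map_id]
  rfl

end ScalarModule

/-! ### Roots of unity in residue characteristic two -/

section RootsOfUnity

variable {O : Type*} [CommRing O] [IsLocalRing O] [CharP (IsLocalRing.ResidueField O) 2]

theorem residue_two : IsLocalRing.residue O 2 = 0 := by
  rw [map_ofNat]
  exact CharTwo.two_eq_zero

/-- In residue characteristic `2`, cube roots of unity are determined by their residues. -/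
theorem eq_of_cube_eq_one {u v : O} (hu : u ^ 3 = 1) (hv : v ^ 3 = 1)
    (h : IsLocalRing.residue O u = IsLocalRing.residue O v) : u = v := by
  have h1 : (u * v ^ 2 - 1) * ((u * v ^ 2) ^ 2 + u * v ^ 2 + 1) = 0 := by
    linear_combination (v ^ 3) ^ 2 * hu + (v ^ 3 + 1) * hv
  have h2 : IsUnit ((u * v ^ 2) ^ 2 + u * v ^ 2 + 1) := by
    rw [← IsLocalRing.residue_ne_zero_iff_isUnit]
    have hv' : IsLocalRing.residue O v ^ 3 = 1 := by rw [← map_pow, hv, map_one]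
    have : IsLocalRing.residue O ((u * v ^ 2) ^ 2 + u * v ^ 2 + 1) = 1 := by
      simp only [map_add, map_mul, map_pow, map_one, h]
      have h20 : (2 : IsLocalRing.ResidueField O) = 0 := CharTwo.two_eq_zero
      linear_combination (IsLocalRing.residue O v ^ 3 + 2) * hv' + h20
    rw [this]
    exact one_ne_zero
  have h3 := (h2.mul_left_eq_zero).1 h1
  linear_combination v * h3 - u * hv

/-- In residue characteristic `2`, roots of unity of `2`-power order are separated modulo `4`. -/
theorem eq_of_four_dvd_sub [IsDomain O] [CharZero O] {m : ℕ} {u v : O} (hu : u ^ 2 ^ m = 1)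
    (hv : v ^ 2 ^ m = 1) (h : 4 ∣ u - v) : u = v := by
  have key : ∀ (m : ℕ) (u : O), u ^ 2 ^ m = 1 → 4 ∣ u - 1 → u = 1 := by
    intro m
    induction m with
    | zero => intro u hu _; simpa using hu
    | succ m ih =>
      intro u hu h
      have h2 : u ^ 2 = 1 := ih (u ^ 2) (by rw [← pow_mul, ← pow_succ', hu])
        (h.trans ⟨u + 1, by ring⟩)
      rcases sq_eq_sq_iff_eq_or_eq_neg.1 (h2.trans (one_pow 2).symm) with h3 | h3
      · exact h3
      -- `u = -1` would make `4` a divisor of `2`, hence `2` a unit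
      · obtain ⟨d, hd⟩ := h
        have h4 : (2 : O) * (2 * d + 1) = 0 := by linear_combination -hd + h3
        have h5 : (2 * d + 1 : O) = 0 := (mul_eq_zero.1 h4).resolve_left two_ne_zero
        have h6 := congrArg (IsLocalRing.residue O) h5
        rw [map_add, map_mul, residue_two, zero_mul, zero_add, map_one, map_zero] at h6
        exact absurd h6 one_ne_zero
  have hm : 1 ≤ 2 ^ m := Nat.one_le_two_pow
  have hv' : v * v ^ (2 ^ m - 1) = 1 := by rw [← pow_succ', Nat.sub_add_cancel hm, hv]
  have h1 := key m (u * v ^ (2 ^ m - 1)) (by rw [mul_pow, ← pow_mul, mul_comm, mul_comm (_ - 1),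
    pow_mul, hv, one_pow, one_mul, hu]) (by
      obtain ⟨d, hd⟩ := h
      exact ⟨d * v ^ (2 ^ m - 1), by linear_combination v ^ (2 ^ m - 1) * hd + hv'⟩)
  linear_combination v * h1 - u * hv'

end RootsOfUnity

/-! ### The group `G_n` and its linear characters -/

section Group

variable {n : ℕ}

/-- The linear characters of `G_n` inflated from `C_3`, with values in any commutative monoid
that has a chosen `ω` with `ω ^ 3 = 1`. -/
def cubeChar {M : Type*} [CommMonoid M] {ω : M} (hω : ω ^ 3 = 1) (n : ℕ) (i : Fin 3) :
    Gn n →* M where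
  toFun g := (ω ^ (i : ℕ)) ^ (g.right.toAdd.val)
  map_one' := by simp
  map_mul' g h := by
    have h3 : (ω ^ (i : ℕ)) ^ 3 = 1 := by
      rw [← pow_mul, mul_comm, pow_mul, hω, one_pow]
    rw [SemidirectProduct.mul_right, toAdd_mul, ZMod.val_add, ← pow_add]
    exact (pow_eq_pow_mod _ h3).symm

theorem cubeChar_apply {M : Type*} [CommMonoid M] {ω : M} (hω : ω ^ 3 = 1) (i : Fin 3)
    (g : Gn n) : cubeChar hω n i g = (ω ^ (i : ℕ)) ^ (g.right.toAdd.val) := rfl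

theorem cubeChar_pow_three {M : Type*} [CommMonoid M] {ω : M} (hω : ω ^ 3 = 1) (i : Fin 3)
    (g : Gn n) : cubeChar hω n i g ^ 3 = 1 := by
  rw [cubeChar_apply, pow_right_comm, pow_right_comm ω, hω, one_pow, one_pow]

theorem pow_two_pow_eq_one (h : HomocyclicGroup n) : h ^ 2 ^ n = 1 := by
  apply Multiplicative.toAdd.injective
  rw [toAdd_pow, toAdd_one]
  have h0 (x : ZMod (2 ^ n)) : (2 ^ n : ℕ) • x = 0 := by
    rw [nsmul_eq_mul, ZMod.natCast_self, zero_mul]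
  exact Prod.ext (h0 _) (h0 _)

theorem eq_one_of_cube_of_two_pow {M : Type*} [Monoid M] {x : M} (h3 : x ^ 3 = 1)
    (h2 : x ^ 2 ^ n = 1) : x = 1 := by
  have h := Nat.dvd_gcd (orderOf_dvd_of_pow_eq_one h3) (orderOf_dvd_of_pow_eq_one h2)
  have hc : Nat.gcd 3 (2 ^ n) = 1 := Nat.Coprime.pow_right n (by norm_num)
  rw [hc, Nat.dvd_one, orderOf_eq_one_iff] at h
  exact h

/-- The product over an orbit of the order-three automorphism is trivial, as `a b (ab)⁻¹ = 1`. -/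
theorem mul_cycleAut_mul_cycleAut (h : HomocyclicGroup n) :
    h * cycleAut n h * cycleAut n (cycleAut n h) = 1 := by
  apply Multiplicative.toAdd.injective
  change ((h.toAdd.1 + -h.toAdd.2 + -(h.toAdd.1 - h.toAdd.2),
    h.toAdd.2 + (h.toAdd.1 - h.toAdd.2) + (-h.toAdd.2 - (h.toAdd.1 - h.toAdd.2))) :
      ZMod (2 ^ n) × ZMod (2 ^ n)) = 0
  ext
  · simp only [Prod.fst_zero]; ring
  · simp only [Prod.snd_zero]; ring

theorem cycleAction_ofAdd_one : cycleAction n (Multiplicative.ofAdd 1) = cycleAut n :=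
  pow_one (cycleAut n)

/-- The nontrivial elements of `C_3` act without nontrivial fixed points. -/
theorem eq_one_of_cycleAction_eq {c : Multiplicative (ZMod 3)} (hc : c ≠ 1)
    {h : HomocyclicGroup n} (hh : cycleAction n c h = h) : h = 1 := by
  have h1 : cycleAut n h = h := by
    have key : c = Multiplicative.ofAdd 1 ∨ c * c = Multiplicative.ofAdd 1 := by
      clear hh
      revert c
      decide
    rw [← cycleAction_ofAdd_one]
    rcases key with rfl | key
    · exact hh
    · rw [← key, map_mul, MulAut.mul_apply, hh, hh]
  have h2 := mul_cycleAut_mul_cycleAut h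
  rw [h1, h1] at h2
  exact eq_one_of_cube_of_two_pow ((pow_three' h).trans h2) (pow_two_pow_eq_one h)

/-- Linear characters of `P × G_n` are trivial on `C_{2^n} × C_{2^n}`. -/
theorem map_inl_eq_one {P M : Type*} [Group P] [CommGroup M] (ψ : P × Gn n →* M)
    (h : HomocyclicGroup n) : ψ (1, SemidirectProduct.inl h) = 1 := by
  have hinv (h : HomocyclicGroup n) :
      ψ (1, SemidirectProduct.inl (cycleAut n h)) = ψ (1, SemidirectProduct.inl h) := by
    have h1 : ((1, SemidirectProduct.inl (cycleAut n h)) : P × Gn n) =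
        (1, SemidirectProduct.inr (Multiplicative.ofAdd 1)) * (1, SemidirectProduct.inl h) *
          (1, SemidirectProduct.inr (Multiplicative.ofAdd 1))⁻¹ := by
      rw [← cycleAction_ofAdd_one, SemidirectProduct.inl_aut]
      ext <;> simp
    rw [h1, map_mul, map_mul, map_inv, mul_inv_cancel_comm]
  let ι : HomocyclicGroup n →* M :=
    ψ.comp ((MonoidHom.inr P (Gn n)).comp SemidirectProduct.inl)
  have hι (h : HomocyclicGroup n) : ψ (1, SemidirectProduct.inl h) = ι h := rfl
  simp only [hι] at hinv ⊢
  refine eq_one_of_cube_of_two_pow (n := n) ?_ (by rw [← map_pow, pow_two_pow_eq_one, map_one])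
  have h2 := congrArg ι (mul_cycleAut_mul_cycleAut h)
  rw [map_mul, map_mul, hinv (cycleAut n h), hinv, map_one] at h2
  exact (pow_three' _).trans h2

/-- For `1 ≠ c ∈ C_3` the coset of `c` is a single conjugacy class, because
`h ↦ h (c h c⁻¹)⁻¹` is injective and hence onto. -/
theorem exists_conj_eq {c : Multiplicative (ZMod 3)} (hc : c ≠ 1) (h : HomocyclicGroup n) :
    ∃ k : HomocyclicGroup n, (⟨h, c⟩ : Gn n) =
      SemidirectProduct.inl k * ⟨1, c⟩ * (SemidirectProduct.inl k)⁻¹ := by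
  have : NeZero (2 ^ n) := ⟨pow_ne_zero n two_ne_zero⟩
  have : Finite (HomocyclicGroup n) := inferInstanceAs (Finite (ZMod (2 ^ n) × ZMod (2 ^ n)))
  let f : HomocyclicGroup n →* HomocyclicGroup n :=
    { toFun := fun k => k * (cycleAction n c k)⁻¹
      map_one' := by simp
      map_mul' := fun x y => by rw [map_mul, mul_inv, mul_mul_mul_comm] }
  have hf : Function.Injective f := (injective_iff_map_eq_one f).2 fun k hk =>
    eq_one_of_cycleAction_eq hc (mul_inv_eq_one.1 hk).symm
  obtain ⟨k, hk⟩ := Finite.surjective_of_injective hf h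
  refine ⟨k, ?_⟩
  rw [← hk]
  ext1 <;> simp [f]

end Group

/-! ### Central elements of the group algebra -/

section Central

theorem coeff_conj_of_mem_center {O G : Type*} [CommRing O] [Group G] {z : MonoidAlgebra O G}
    (hz : z ∈ Set.center (MonoidAlgebra O G)) (x g : G) :
    z.coeff (x * g * x⁻¹) = z.coeff g := by
  have h := congrArg (fun y : MonoidAlgebra O G => y.coeff (x * g))
    ((Set.mem_center_iff.1 hz).comm (MonoidAlgebra.of O G x))
  simpa [MonoidAlgebra.of_apply] using h

theorem lift_eq_sum {O G : Type*} [CommRing O] [Group G] [Fintype G] (χ : G →* O)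
    (z : MonoidAlgebra O G) : MonoidAlgebra.lift O O G χ z = ∑ g, z.coeff g * χ g := by
  rw [MonoidAlgebra.lift_apply, Finsupp.sum_fintype _ _ (by simp)]
  rfl

/-- The linear character `θ ⊗ ψ` of `P × H`, multiplicatively. -/
def tensorHom {P H M : Type*} [Group P] [Group H] [CommMonoid M] (θ : P →* M) (ψ : H →* M) :
    P × H →* M :=
  MonoidHom.coprod θ ψ

theorem tensorHom_apply {P H M : Type*} [Group P] [Group H] [CommMonoid M] (θ : P →* M)
    (ψ : H →* M) (x : P × H) : tensorHom θ ψ x = θ x.1 * ψ x.2 := rfl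

instance (n : ℕ) : Finite (HomocyclicGroup n) :=
  have : NeZero (2 ^ n) := ⟨pow_ne_zero n two_ne_zero⟩
  inferInstanceAs (Finite (ZMod (2 ^ n) × ZMod (2 ^ n)))

instance (n : ℕ) : Finite (Gn n) := Finite.of_equiv _ SemidirectProduct.equivProd.symm

theorem card_homocyclicGroup (n : ℕ) : Nat.card (HomocyclicGroup n) = 2 ^ n * 2 ^ n := by
  change Nat.card (ZMod (2 ^ n) × ZMod (2 ^ n)) = _
  rw [Nat.card_prod, Nat.card_zmod]

/-- The central characters of `θ ⊗ χ_i` and `θ ⊗ χ_j` agree modulo `4`: the two characters agree on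
`P × C_{2^n} × C_{2^n}`, and off it each element has `4 ^ n` conjugates under `C_{2^n} × C_{2^n}`,
at all of which `z` has the same coefficient. -/
theorem four_dvd_lift_sub_lift {O P : Type*} [CommRing O] [Group P] [Finite P] {n : ℕ}
    (hn : 1 ≤ n) {ω : O} (hω : ω ^ 3 = 1) (θ : P →* O) (i j : Fin 3)
    {z : MonoidAlgebra O (P × Gn n)} (hz : z ∈ Set.center (MonoidAlgebra O (P × Gn n))) :
    4 ∣ MonoidAlgebra.lift O O _ (tensorHom θ (cubeChar hω n i)) z -
      MonoidAlgebra.lift O O _ (tensorHom θ (cubeChar hω n j)) z := by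
  classical
  have := Fintype.ofFinite P
  have := Fintype.ofFinite (HomocyclicGroup n)
  have := Fintype.ofFinite (Gn n)
  rw [lift_eq_sum, lift_eq_sum, ← Finset.sum_sub_distrib, Fintype.sum_prod_type]
  refine Finset.dvd_sum fun x _ => ?_
  rw [← SemidirectProduct.equivProd.symm.sum_comp, Fintype.sum_prod_type_right]
  refine Finset.dvd_sum fun c _ => ?_
  by_cases hc : c = 1
  · subst hc
    refine Finset.dvd_sum fun h _ => ?_
    simp [tensorHom_apply, cubeChar_apply, SemidirectProduct.equivProd]
  · have hconst (h : HomocyclicGroup n) : z.coeff (x, ⟨h, c⟩) = z.coeff (x, ⟨1, c⟩) := by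
      obtain ⟨k, hk⟩ := exists_conj_eq hc h
      rw [← coeff_conj_of_mem_center hz (1, SemidirectProduct.inl k) (x, ⟨1, c⟩), hk]
      simp
    have h4 : (4 : O) ∣ (Fintype.card (HomocyclicGroup n) : O) := by
      rw [← Nat.card_eq_fintype_card, card_homocyclicGroup]
      have : (4 : ℕ) ∣ 2 ^ n * 2 ^ n :=
        mul_dvd_mul (dvd_pow_self 2 (by omega)) (dvd_pow_self 2 (by omega))
      exact_mod_cast Nat.cast_dvd_cast (α := O) this
    rw [Finset.sum_congr rfl (g := fun _ => z.coeff (x, ⟨1, c⟩) *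
      (θ x * (ω ^ (i : ℕ)) ^ c.toAdd.val) - z.coeff (x, ⟨1, c⟩) *
      (θ x * (ω ^ (j : ℕ)) ^ c.toAdd.val)), Finset.sum_const, Finset.card_univ, nsmul_eq_mul]
    · exact h4.mul_right _
    · intro h _
      rw [← hconst h]
      rfl

end Central

/-! ### Fixed vectors and eigenvectors -/

section FixedVectors

/-- A finite `p`-group acting on a nontrivial abelian group of exponent `p` fixes a nonzero
element, because the subgroup spanned by an orbit is a finite `p`-group. -/
theorem exists_ne_zero_forall_smul_eq {p : ℕ} [Fact p.Prime] {H T : Type*} [Group H] [Finite H]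
    (hH : IsPGroup p H) [AddCommGroup T] [Nontrivial T] [Module (ZMod p) T]
    [DistribMulAction H T] : ∃ t : T, t ≠ 0 ∧ ∀ h : H, h • t = t := by
  obtain ⟨t₀, ht₀⟩ := exists_ne (0 : T)
  let W : Submodule (ZMod p) T := Submodule.span (ZMod p) (MulAction.orbit H t₀)
  have := Module.Finite.span_of_finite (ZMod p) 
    (show (MulAction.orbit H t₀).Finite from Set.finite_range _)
  have : Finite ↥W := Module.finite_of_finite (ZMod p)
  have hstab (h : H) (t : T) (ht : t ∈ W) : h • t ∈ W := by
    induction ht using Submodule.span_induction with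
    | mem t ht => exact Submodule.subset_span (MulAction.smul_orbit_subset h t₀ ⟨t, ht, rfl⟩)
    | zero => rw [smul_zero]; exact W.zero_mem
    | add a b _ _ ha hb => rw [smul_add]; exact W.add_mem ha hb
    | smul c a _ ha =>
      have : h • c • a = c • h • a :=
        map_smul ((DistribSMul.toAddMonoidHom T h).toZModLinearMap p) c a
      rw [this]
      exact W.smul_mem c ha
  let _ : MulAction H W :=
    { smul := fun h w => ⟨h • (w : T), hstab h w w.2⟩
      one_smul := fun w => Subtype.ext (one_smul H (w : T))
      mul_smul := fun a b w => Subtype.ext (mul_smul a b (w : T)) }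
  have hsmul (h : H) (w : W) : ((h • w : W) : T) = h • (w : T) := rfl
  have hnt : Nontrivial W :=
    ⟨⟨⟨t₀, Submodule.subset_span (MulAction.mem_orbit_self t₀)⟩, 0, fun h =>
      ht₀ (congrArg Subtype.val h)⟩⟩
  have hcard : p ∣ Nat.card W := by
    rw [Module.natCard_eq_pow_finrank (K := ZMod p), Nat.card_zmod]
    exact dvd_pow_self p (Module.finrank_pos).ne'
  obtain ⟨w, hw, hne⟩ := hH.exists_fixed_point_of_prime_dvd_card_of_fixed_point W hcard
    (a := 0) (fun h => Subtype.ext (smul_zero h))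
  exact ⟨w, fun h => hne (Subtype.ext h.symm), fun h => congrArg Subtype.val (hw h)⟩

/-- A module over `𝒪[P × G_n]` killed by `2` contains a line on which `P × G_n` acts through one
of the three linear characters of `C_3`. -/
theorem exists_ne_zero_smul_eq_cubeChar {O P : Type*} [CommRing O] [Group P] [Finite P]
    (hP : IsPGroup 2 P) {n : ℕ} {ω : O} (hω : ω ^ 2 + ω + 1 = 0) (hω3 : ω ^ 3 = 1) {T : Type*}
    [AddCommGroup T] [Nontrivial T] [Module O T] [Module (MonoidAlgebra O (P × Gn n)) T]
    [IsScalarTower O (MonoidAlgebra O (P × Gn n)) T] (hT : ∀ t : T, (2 : ℕ) • t = 0) :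
    ∃ (i : Fin 3) (t : T), t ≠ 0 ∧ ∀ g : P × Gn n,
      MonoidAlgebra.of O (P × Gn n) g • t = cubeChar hω3 n i g.2 • t := by
  let _ : DistribMulAction (P × Gn n) T :=
    DistribMulAction.compHom T (MonoidAlgebra.of O (P × Gn n))
  have hsmul (g : P × Gn n) (t : T) : MonoidAlgebra.of O (P × Gn n) g • t = g • t := rfl
  have hcomm (g : P × Gn n) (a : O) (t : T) : g • a • t = a • g • t := by
    rw [← hsmul, ← hsmul, ← algebraMap_smul (MonoidAlgebra O (P × Gn n)) a t,
      ← algebraMap_smul (MonoidAlgebra O (P × Gn n)) a, ← mul_smul, ← mul_smul,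
      Algebra.commutes]
  let N := P × HomocyclicGroup n
  let ι : N →* P × Gn n := MonoidHom.prodMap (MonoidHom.id P) SemidirectProduct.inl
  have hN : IsPGroup 2 N := by
    rw [IsPGroup.iff_card] at hP ⊢
    obtain ⟨k, hk⟩ := hP
    exact ⟨k + (n + n), by rw [Nat.card_prod, hk, card_homocyclicGroup, pow_add, pow_add]⟩
  let _ : DistribMulAction N T := DistribMulAction.compHom T ι
  let _ : Module (ZMod 2) T := AddCommGroup.zmodModule hT
  obtain ⟨v, hv0, hv⟩ := exists_ne_zero_forall_smul_eq (p := 2) hN (T := T)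
  have hv (y : P × Gn n) (hy : y.2.right = 1) : y • v = v := by
    have : y = ι (y.1, y.2.left) := by
      exact Prod.ext rfl (SemidirectProduct.ext rfl hy)
    rw [this]
    exact hv _
  let c : P × Gn n := (1, SemidirectProduct.inr (Multiplicative.ofAdd 1))
  have hc3 : c ^ 3 = 1 := by
    have : (Multiplicative.ofAdd 1 : Multiplicative (ZMod 3)) ^ 3 = 1 := by decide
    rw [Prod.pow_mk, one_pow, ← map_pow, this, map_one]
    rfl
  have hccc : c • c • c • v = v := by rw [← mul_smul, ← mul_smul, ← pow_three', hc3, one_smul]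
  -- translates of a fixed vector are fixed, since the `2`-subgroup is normal
  have hfix (g y : P × Gn n) (hy : y.2.right = 1) : y • g • v = g • v := by
    have h1 : y * g = g * (g⁻¹ * y * g) := by group
    rw [← mul_smul, h1, mul_smul, hv (g⁻¹ * y * g) (by simp [hy])]
  -- the `ω ^ i`-eigencomponent of `v` for `c`
  let u (i : Fin 3) : T := v + (ω ^ (i : ℕ)) ^ 2 • c • v + ω ^ (i : ℕ) • c • c • v
  have hω3i (i : Fin 3) : (ω ^ (i : ℕ)) ^ 3 = 1 := by rw [pow_right_comm, hω3, one_pow]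
  have hcu (i : Fin 3) : c • u i = ω ^ (i : ℕ) • u i := by
    simp only [u, smul_add, hcomm, hccc, ← mul_smul (α := O)]
    rw [← pow_succ', hω3i, one_smul, ← pow_two]
    abel
  have hyu (i : Fin 3) (y : P × Gn n) (hy : y.2.right = 1) : y • u i = u i := by
    simp only [u, smul_add, hcomm, hv y hy, hfix c y hy]
    rw [← mul_smul c c v, hfix (c * c) y hy]
  have hsum : u 0 + u 1 + u 2 = v := by
    have h1 : u 0 + u 1 + u 2 = v + (2 : ℕ) • v + (1 + ω ^ 2 + ω ^ 4) • c • v +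
        (1 + ω + ω ^ 2) • c • c • v := by
      simp only [u, Fin.val_zero, Fin.val_one, Fin.val_two, pow_zero, pow_one, one_smul,
        add_smul, two_nsmul, zero_mul, Nat.reduceMul, ← pow_mul]
      abel
    have h2 : 1 + ω ^ 2 + ω ^ 4 = 0 := by linear_combination hω + ω * hω3
    have h3 : 1 + ω + ω ^ 2 = 0 := by linear_combination hω
    rw [h1, h2, h3, hT, zero_smul, zero_smul, add_zero, add_zero, add_zero]
  obtain ⟨i, hi⟩ : ∃ i, u i ≠ 0 := by
    by_contra! h
    rw [h, h, h, add_zero, add_zero] at hsum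
    exact hv0 hsum.symm
  refine ⟨i, u i, hi, fun g => ?_⟩
  have hpow (k : ℕ) : c ^ k • u i = (ω ^ (i : ℕ)) ^ k • u i := by
    induction k with
    | zero => rw [pow_zero, pow_zero, one_smul, one_smul]
    | succ k ih => rw [pow_succ', mul_smul, ih, hcomm, hcu, pow_succ, mul_smul]
  have hg : g = (g * (c ^ g.2.right.toAdd.val)⁻¹) * c ^ g.2.right.toAdd.val := by group
  have hr : (g * (c ^ g.2.right.toAdd.val)⁻¹).2.right = 1 := by
    have h1 : (c ^ g.2.right.toAdd.val).2.right = g.2.right := by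
      have : Multiplicative.ofAdd (1 : ZMod 3) ^ g.2.right.toAdd.val = g.2.right := by
        rw [← ofAdd_nsmul, nsmul_one, ZMod.natCast_zmod_val, ofAdd_toAdd]
      rw [Prod.pow_snd, ← map_pow, this, SemidirectProduct.right_inr]
    rw [Prod.snd_mul, Prod.snd_inv, SemidirectProduct.mul_right, SemidirectProduct.inv_right, h1,
      mul_inv_cancel]
  rw [hsmul, hg, mul_smul, hpow, hcomm, hyu i _ hr, ← hg]
  rfl

end FixedVectors

/-! ### The image of a linear character under a Morita auto-equivalence -/

section MoritaLinear

open CategoryTheory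

universe v w

variable {O : Type w} [CommRing O] {P : Type v} [Group P] {n : ℕ}

/-- The `𝒪`-algebra homomorphism `𝒪G → 𝒪` given by a linear character of `G`. -/
noncomputable abbrev charHom {G : Type*} [Group G] (χ : G →* O) : MonoidAlgebra O G →ₐ[O] O :=
  MonoidAlgebra.lift O O G χ

theorem smul_eq_charHom_smul {G : Type*} [Group G] {M : Type*} [AddCommGroup M] [Module O M]
    [Module (MonoidAlgebra O G) M] [IsScalarTower O (MonoidAlgebra O G) M] (χ : G →* O) {t : M}
    (h : ∀ g, MonoidAlgebra.of O G g • t = χ g • t) (a : MonoidAlgebra O G) :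
    a • t = charHom χ a • t := by
  induction a using MonoidAlgebra.induction_on with
  | of g => rw [h, MonoidAlgebra.lift_of]
  | add a b ha hb => rw [add_smul, ha, hb, map_add, add_smul]
  | smul c a ha => rw [smul_assoc, ha, map_smul, smul_assoc]

variable [IsLocalRing O]

/-- The reduction of `charHom χ` modulo the maximal ideal. -/
noncomputable abbrev residueCharHom {G : Type*} [Group G] (χ : G →* O) :
    MonoidAlgebra O G →+* IsLocalRing.ResidueField O :=
  (IsLocalRing.residue O).comp (charHom χ : MonoidAlgebra O G →+* O)

/-- If the reduction of a linear character goes to a module of rank one over the residue field, on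
which `G` acts through `χ`, then by Nakayama's lemma the corresponding lattice goes to a lattice of
rank one, on which `G` acts through a lift of the reduction of `χ`. -/
theorem exists_linear_image [IsDomain O] [IsPrincipalIdealRing O] {G : Type v} [Group G]
    (e : MoritaEquivalence O (MonoidAlgebra O G) (MonoidAlgebra O G)) (f χ : G →* O)
    (hχ : ∀ (g : G) (t : e.eqv.functor.obj (scalarModule.{max w v, v, w} (residueCharHom f))),
      MonoidAlgebra.of O G g • t = χ g • t)
    (hS : ∃ t : e.eqv.functor.obj (scalarModule.{max w v, v, w} (residueCharHom f)), t ≠ 0 ∧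
      ∀ t', ∃ c : O, t' = c • t)
    (hfin : Module.Finite O (e.eqv.functor.obj (scalarModule.{max w v, v, w}
      (charHom f : MonoidAlgebra O G →+* O))))
    (hfree : Module.Free O (e.eqv.functor.obj (scalarModule.{max w v, v, w}
      (charHom f : MonoidAlgebra O G →+* O)))) :
    Module.finrank O (e.eqv.functor.obj (scalarModule.{max w v, v, w}
      (charHom f : MonoidAlgebra O G →+* O))) = 1 ∧
    ∃ ψ : G →* O, (∀ g, IsLocalRing.residue O (ψ g) = IsLocalRing.residue O (χ g)) ∧
      ∀ (g : G) (m : e.eqv.functor.obj (scalarModule.{max w v, v, w}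
        (charHom f : MonoidAlgebra O G →+* O))), MonoidAlgebra.of O G g • m = ψ g • m := by
  obtain ⟨π, hπ⟩ := (IsPrincipalIdealRing.principal (IsLocalRing.maximalIdeal O)).principal
  obtain ⟨q, hq, hker⟩ := exists_reduction e hπ (charHom f)
  obtain ⟨t, ht0, ht⟩ := hS
  obtain ⟨m, hm⟩ := hq t
  have hqsmul (c : O) (x) : q (c • x) = c • q x := by
    rw [← algebraMap_smul (MonoidAlgebra O G) c x, q.map_smul, algebraMap_smul]
  -- a lift of a generator modulo `π` is a generator
  have hgen : ∀ x, ∃ c : O, c • m = x := by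
    have h : (⊤ : Submodule O _) ≤ Submodule.span O {m} := by
      refine Submodule.le_of_le_smul_of_le_jacobson_bot (I := IsLocalRing.maximalIdeal O)
        hfin.fg_top (IsLocalRing.maximalIdeal_le_jacobson ⊥) fun x _ => ?_
      obtain ⟨c, hc⟩ := ht (q x)
      obtain ⟨y, hy⟩ := hker (x - c • m) (by rw [map_sub, hqsmul, hm, hc, sub_self])
      rw [← sub_add_cancel x (c • m), add_comm]
      refine Submodule.add_mem_sup (Submodule.smul_mem _ c (Submodule.mem_span_singleton_self m)) ?_
      rw [hy]
      exact Submodule.smul_mem_smul (hπ ▸ Ideal.mem_span_singleton_self π) Submodule.mem_top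
    exact fun x => Submodule.mem_span_singleton.1 (h Submodule.mem_top)
  have hm0 : m ≠ 0 := by
    rintro rfl
    exact ht0 (by rw [← hm, map_zero])
  have hrank : Module.finrank O (e.eqv.functor.obj (scalarModule.{max w v, v, w}
      (charHom f : MonoidAlgebra O G →+* O))) = 1 := by
    have : Nontrivial (e.eqv.functor.obj (scalarModule.{max w v, v, w}
      (charHom f : MonoidAlgebra O G →+* O))) := ⟨m, 0, hm0⟩
    exact le_antisymm (finrank_le_one m hgen) Module.finrank_pos
  have hinj {a b : O} (h : a • m = b • m) : a = b := smul_left_injective O hm0 h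
  choose ψ hψ using fun g : G => hgen (MonoidAlgebra.of O G g • m)
  have hall (g : G) (x : e.eqv.functor.obj (scalarModule.{max w v, v, w}
      (charHom f : MonoidAlgebra O G →+* O))) : MonoidAlgebra.of O G g • x = ψ g • x := by
    obtain ⟨c, rfl⟩ := hgen x
    rw [smul_comm _ c m, ← hψ, smul_comm]
  refine ⟨hrank, ⟨⟨ψ, ?_⟩, fun g h => ?_⟩, fun g => ?_, hall⟩
  · exact hinj (by rw [hψ, map_one, one_smul, one_smul])
  · change ψ (g * h) = ψ g * ψ h
    exact hinj (by rw [hψ, map_mul, mul_smul, ← hψ h, hall, mul_smul])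
  · by_contra hne
    have hu : IsUnit (ψ g - χ g) := by
      rw [← IsLocalRing.residue_ne_zero_iff_isUnit, map_sub]
      exact sub_ne_zero.2 hne
    have h0 : (ψ g - χ g) • t = 0 := by
      rw [sub_smul, ← hχ, ← hm, ← hqsmul, ← hall, q.map_smul, sub_self]
    exact ht0 ((hu.smul_eq_zero).1 h0)

variable [CharP (IsLocalRing.ResidueField O) 2]

theorem residue_eq_one_of_isPGroup (hP : IsPGroup 2 P) (θ : P →* O) (x : P) :
    IsLocalRing.residue O (θ x) = 1 := by
  obtain ⟨k, hk⟩ := hP x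
  have h1 : (IsLocalRing.residue O (θ x) - 1) ^ 2 ^ k = 0 := by
    rw [sub_pow_char_pow, ← map_pow, ← map_pow, hk, map_one, map_one, one_pow, sub_self]
  exact sub_eq_zero.1 (pow_eq_zero_iff (pow_ne_zero k two_ne_zero) |>.1 h1)

theorem residueCharHom_tensorHom (hP : IsPGroup 2 P) (θ : P →* O) (ψ : Gn n →* O) :
    residueCharHom (tensorHom θ ψ) = residueCharHom (tensorHom (1 : P →* O) ψ) := by
  refine MonoidAlgebra.ringHom_ext (fun r => ?_) fun g => ?_
  · simp
  · simp [tensorHom_apply, residue_eq_one_of_isPGroup hP θ]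

/-- The simple `𝒪[P × G_n]`-modules have rank one over the residue field and come from linear
characters of `C_3`; here this is applied to the image of such a module under a Morita
auto-equivalence. -/
theorem exists_cubeChar_residue [Finite P] {ω : O} (hω : ω ^ 2 + ω + 1 = 0) (hω3 : ω ^ 3 = 1)
    (e : MoritaEquivalence O (MonoidAlgebra O (P × Gn n)) (MonoidAlgebra O (P × Gn n)))
    (hP : IsPGroup 2 P) (χ : P × Gn n →* O) :
    ∃ i : Fin 3,
      (∀ (g : P × Gn n)
        (t : e.eqv.functor.obj (scalarModule.{max w v, v, w} (residueCharHom χ))),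
        MonoidAlgebra.of O (P × Gn n) g • t = cubeChar hω3 n i g.2 • t) ∧
      ∃ t : e.eqv.functor.obj (scalarModule.{max w v, v, w} (residueCharHom χ)), t ≠ 0 ∧
        ∀ t', ∃ c : O, t' = c • t := by
  let S := scalarModule.{max w v, v, w} (residueCharHom χ)
  have : Simple S := simple_scalarModule_residue (charHom χ)
  have hsimp : IsSimpleModule (MonoidAlgebra O (P × Gn n)) (e.eqv.functor.obj S) :=
    (simple_iff_isSimpleModule' _).1 (simple_obj e.eqv.functor S)
  have h2S : (2 : O) • 𝟙 S = 0 := by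
    ext t
    change ULift.up (residueCharHom χ (algebraMap O _ 2) * _) = ULift.up 0
    rw [RingHom.comp_apply]
    simp only [AlgHom.coe_toRingHom, AlgHom.commutes, Algebra.algebraMap_self_apply]
    rw [residue_two, zero_mul]
  have h2 (t : e.eqv.functor.obj S) : (2 : ℕ) • t = 0 := by
    have h := congrArg e.eqv.functor.map h2S
    rw [Functor.map_smul, Functor.map_zero, CategoryTheory.Functor.map_id] at h
    have h' : (2 : O) • t = 0 := congrArg (fun f => f.hom t) h
    rwa [two_smul, ← two_nsmul] at h'
  have := IsSimpleModule.nontrivial (MonoidAlgebra O (P × Gn n)) (e.eqv.functor.obj S)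
  obtain ⟨i, t, ht0, ht⟩ := exists_ne_zero_smul_eq_cubeChar (n := n) hP hω hω3 h2
  have hspan (t' : e.eqv.functor.obj S) : ∃ c : O, t' = c • t := by
    obtain ⟨a, rfl⟩ := IsSimpleModule.toSpanSingleton_surjective (MonoidAlgebra O (P × Gn n)) ht0 t'
    exact ⟨_, smul_eq_charHom_smul ((cubeChar hω3 n i).comp (MonoidHom.snd P (Gn n))) ht a⟩
  refine ⟨i, fun g t' => ?_, t, ht0, hspan⟩
  obtain ⟨c, rfl⟩ := hspan t'
  rw [smul_comm _ c t, ht, smul_comm]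

/-- The index `σ i` depends only on `i`, since the `θ ⊗ χ_i` for varying `θ` have the same reduction. -/
theorem exists_index [Finite P] {ω : O} (hω : ω ^ 2 + ω + 1 = 0) (hω3 : ω ^ 3 = 1)
    (e : MoritaEquivalence O (MonoidAlgebra O (P × Gn n)) (MonoidAlgebra O (P × Gn n)))
    (hP : IsPGroup 2 P) :
    ∃ σ : Fin 3 → Fin 3, ∀ (θ : P →* O) (i : Fin 3),
      (∀ (g : P × Gn n) (t : e.eqv.functor.obj (scalarModule.{max w v, v, w}
          (residueCharHom (tensorHom θ (cubeChar hω3 n i))))),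
        MonoidAlgebra.of O (P × Gn n) g • t = cubeChar hω3 n (σ i) g.2 • t) ∧
      ∃ t : e.eqv.functor.obj (scalarModule.{max w v, v, w}
          (residueCharHom (tensorHom θ (cubeChar hω3 n i)))), t ≠ 0 ∧
        ∀ t', ∃ c : O, t' = c • t := by
  choose σ hσ using fun i : Fin 3 =>
    exists_cubeChar_residue hω hω3 e hP (tensorHom 1 (cubeChar hω3 n i))
  refine ⟨σ, fun θ i => ?_⟩
  rw [residueCharHom_tensorHom hP]
  exact hσ i

end MoritaLinear

/-! ### Irreducible characters of abelian groups -/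

section LinearCharacters

/-- If a group acts by scalars, subrepresentations are the same as subspaces. -/
def subrepresentationOrderIso {K G V : Type*} [Field K] [Group G] [AddCommGroup V] [Module K V]
    (ρ : Representation K G V) (h : ∀ g, ∃ c : K, ∀ v, ρ g v = c • v) :
    Subrepresentation ρ ≃o Submodule K V where
  toFun W := W.toSubmodule
  invFun W := ⟨W, fun g v hv => by
    obtain ⟨c, hc⟩ := h g
    rw [hc]
    exact W.smul_mem c hv⟩
  left_inv _ := rfl
  right_inv _ := rfl
  map_rel_iff' := Iff.rfl

theorem coe_mem_Irr {K G : Type*} [Field K] [Group G] (l : G →* K) : (l : G → K) ∈ Irr K G := by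
  let ρ : Representation K G (Fin 1 → K) :=
    { toFun := fun g => l g • LinearMap.id
      map_one' := by rw [map_one, one_smul]; rfl
      map_mul' := fun g h => LinearMap.ext fun v => by
        change l (g * h) • v = l g • l h • v
        rw [map_mul, mul_smul] }
  refine ⟨1, ρ, ?_, ?_⟩
  · have : IsSimpleOrder (Submodule K (Fin 1 → K)) :=
      is_simple_module_of_finrank_eq_one (Module.finrank_fin_fun K)
    exact (subrepresentationOrderIso ρ fun g => ⟨l g, fun v => rfl⟩).isSimpleOrder
  · ext g
    simp [Representation.character, ρ]

/-- The irreducible characters of a finite abelian group over a field with enough roots of unity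
are linear. -/
theorem exists_eq_coe_of_mem_Irr {K P : Type*} [Field K] [CommGroup P] [Finite P] {ζ : K}
    (hζ : IsPrimitiveRoot ζ (Nat.card P)) {χ : P → K} (hχ : χ ∈ Irr K P) :
    ∃ l : P →* K, χ = l := by
  obtain ⟨d, ρ, hρ, rfl⟩ := hχ
  have hnt : Nontrivial (Fin d → K) := by
    obtain ⟨W, W', hne⟩ := exists_pair_ne (Subrepresentation ρ)
    by_contra h
    rw [not_nontrivial_iff_subsingleton] at h
    exact hne (Subrepresentation.toSubmodule_injective (Subsingleton.elim _ _))
  -- each operator has an eigenvalue, as it is annihilated by the split polynomial `X ^ |P| - 1`,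
  -- and its eigenspace is a subrepresentation because `P` is abelian
  have hscalar (g : P) : ∃ c : K, ∀ v, ρ g v = c • v := by
    have hann : Polynomial.aeval (ρ g) (Polynomial.X ^ Nat.card P - 1 : Polynomial K) = 0 := by
      rw [map_sub, map_pow, Polynomial.aeval_X, map_one, ← map_pow, pow_card_eq_one', map_one,
        sub_self]
    have hsplit : (minpoly K (ρ g)).Splits := by
      have h := Polynomial.X_pow_sub_one_splits hζ
      refine h.of_dvd ?_ (minpoly.dvd K _ hann)
      exact Polynomial.X_pow_sub_C_ne_zero Nat.card_pos 1
    obtain ⟨c, hc⟩ := hsplit.exists_eval_eq_zero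
      (minpoly.degree_pos (Algebra.IsIntegral.isIntegral (ρ g))).ne'
    have hev := Module.End.hasEigenvalue_of_isRoot hc
    let W : Subrepresentation ρ := ⟨Module.End.eigenspace (ρ g) c, fun h v hv => by
      rw [Module.End.mem_eigenspace_iff] at hv ⊢
      rw [← Module.End.mul_apply, ← map_mul, mul_comm, map_mul, Module.End.mul_apply, hv, map_smul]⟩
    refine ⟨c, fun v => ?_⟩
    rcases eq_bot_or_eq_top W with hW | hW
    · exact absurd (congrArg Subrepresentation.toSubmodule hW) hev
    · have hv : v ∈ W := hW ▸ trivial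
      exact Module.End.mem_eigenspace_iff.1 hv
  have hs : IsSimpleOrder (Submodule K (Fin d → K)) :=
    (subrepresentationOrderIso ρ hscalar).symm.isSimpleOrder
  have hd : Module.finrank K (Fin d → K) = 1 :=
    isSimpleModule_iff_finrank_eq_one.1 ((isSimpleModule_iff K _).2 hs)
  choose c hc using hscalar
  have hchar (g : P) : ρ.character g = c g := by
    have : ρ g = c g • LinearMap.id := LinearMap.ext (hc g)
    rw [Representation.character, this, map_smul, LinearMap.trace_id, hd]
    simp
  obtain ⟨v, hv⟩ := exists_ne (0 : Fin d → K)
  have hinj {a b : K} (h : a • v = b • v) : a = b := smul_left_injective K hv h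
  refine ⟨⟨⟨c, hinj ?_⟩, fun g h => hinj ?_⟩, funext hchar⟩
  · rw [← hc, map_one, one_smul]; rfl
  · change c (g * h) • v = (c g * c h) • v
    rw [← hc, map_mul, Module.End.mul_apply, hc h, map_smul, hc g, ← mul_smul, mul_comm]

/-- A linear character has its values in any integrally closed ring with the given fraction
field. -/
theorem exists_comp_eq {O K G : Type*} [CommRing O] [IsDomain O] [IsIntegrallyClosed O] [Field K]
    [Algebra O K] [IsFractionRing O K] [Group G] [Finite G] (l : G →* K) :
    ∃ θ : G →* O, ∀ g, algebraMap O K (θ g) = l g := by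
  have h (g : G) : ∃ y : O, algebraMap O K y = l g := by
    refine IsIntegrallyClosed.algebraMap_eq_of_integral ?_
    refine IsIntegral.of_pow (n := Nat.card G) Nat.card_pos ?_
    rw [← map_pow, pow_card_eq_one', map_one]
    exact isIntegral_one
  choose θ hθ using h
  have hinj := IsFractionRing.injective O K
  exact ⟨⟨⟨θ, hinj (by rw [hθ, map_one, map_one])⟩, fun x y => hinj (by
    change algebraMap O K (θ (x * y)) = algebraMap O K (θ x * θ y)
    rw [map_mul, hθ, hθ, hθ, map_mul])⟩, hθ⟩

/-- The irreducible characters of an abelian group `P`, as homomorphisms to the integral closed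
ring `𝒪`. -/
noncomputable def irrEquiv {O K P : Type*} [CommRing O] [IsDomain O] [IsIntegrallyClosed O]
    [Field K] [Algebra O K] [IsFractionRing O K] [CommGroup P] [Finite P] {ζ : K}
    (hζ : IsPrimitiveRoot ζ (Nat.card P)) : (P →* O) ≃ Irr K P :=
  Equiv.ofBijective
    (fun θ => ⟨((algebraMap O K : O →* K).comp θ : P →* K), coe_mem_Irr _⟩) (by
      constructor
      · intro θ θ' h
        ext x
        exact IsFractionRing.injective O K (congrFun (congrArg Subtype.val h) x)
      · rintro ⟨χ, hχ⟩
        obtain ⟨l, rfl⟩ := exists_eq_coe_of_mem_Irr hζ hχ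
        obtain ⟨θ, hθ⟩ := exists_comp_eq (O := O) l
        exact ⟨θ, Subtype.ext (funext hθ)⟩)

end LinearCharacters

/-! ### The induced permutation on linear characters -/

section Induced

open CategoryTheory

universe u v w

variable {O : Type w} [CommRing O] {K : Type u} [Field K] [Algebra O K]

theorem latticeChar_of_smul {G : Type v} [Group G] (V : ModuleCat (MonoidAlgebra O G))
    [Module.Finite O V] [Module.Free O V] (hV : Module.finrank O V = 1) {g : G} {c : O}
    (h : ∀ x : V, MonoidAlgebra.of O G g • x = c • x) :
    latticeChar O K V g = algebraMap O K c := by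
  have : Algebra.lsmul O O V (MonoidAlgebra.of O G g) = c • LinearMap.id := LinearMap.ext h
  rw [latticeChar, this, map_smul, LinearMap.trace_id, hV]
  simp

theorem latticeChar_scalarModule [IsDomain O] {G : Type v} [Group G] (χ : G →* O) :
    Module.Finite O (scalarModule.{max w v, v, w} (charHom χ : MonoidAlgebra O G →+* O)) ∧
    Module.Free O (scalarModule.{max w v, v, w} (charHom χ : MonoidAlgebra O G →+* O)) ∧
    latticeChar O K (scalarModule.{max w v, v, w} (charHom χ : MonoidAlgebra O G →+* O)) =
      fun g => algebraMap O K (χ g) := by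
  have h1 : Module.Finite O
      (scalarModule.{max w v, v, w} (charHom χ : MonoidAlgebra O G →+* O)) :=
    Module.Finite.equiv (scalarModuleEquiv.{max w v, v, w} (charHom χ)).symm
  have h2 : Module.Free O
      (scalarModule.{max w v, v, w} (charHom χ : MonoidAlgebra O G →+* O)) :=
    Module.Free.of_equiv (scalarModuleEquiv.{max w v, v, w} (charHom χ)).symm
  refine ⟨h1, h2, funext fun g => latticeChar_of_smul _ ?_ fun x => ?_⟩
  · rw [(scalarModuleEquiv.{max w v, v, w} (charHom χ)).finrank_eq, Module.finrank_self]
  · rw [smul_scalarModule, MonoidAlgebra.lift_of]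

variable [IsLocalRing O] [CharP (IsLocalRing.ResidueField O) 2] {P : Type v} [CommGroup P] {n : ℕ}

/-- The linear characters of `P × G_n` are the products of those of `P` with the three linear
characters of `C_3`; the factor on `C_3` is determined by its residue. -/
theorem eq_tensorHom_cubeChar {ω : O} (hω3 : ω ^ 3 = 1) {ψ : P × Gn n →* O} {i : Fin 3}
    (h : ∀ g, IsLocalRing.residue O (ψ g) = IsLocalRing.residue O (cubeChar hω3 n i g.2)) :
    ψ = tensorHom (ψ.comp (MonoidHom.inl P (Gn n))) (cubeChar hω3 n i) := by
  have hright (c : Multiplicative (ZMod 3)) : ψ (1, SemidirectProduct.inr c) =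
      cubeChar hω3 n i (SemidirectProduct.inr c) := by
    refine eq_of_cube_eq_one ?_ (cubeChar_pow_three hω3 i _) (h _)
    have hc : c ^ 3 = 1 := by revert c; decide
    rw [← map_pow, Prod.pow_mk, ← map_pow, hc, map_one, one_pow]
    exact map_one ψ
  have hleft (k : HomocyclicGroup n) : ψ (1, SemidirectProduct.inl k) = 1 := by
    have := map_inl_eq_one ψ.toHomUnits k
    exact congrArg Units.val this
  ext ⟨x, g⟩
  have hg : (x, g) = ((x, 1) : P × Gn n) *
      ((1, SemidirectProduct.inl g.left) * (1, SemidirectProduct.inr g.right)) := by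
    rw [Prod.mk_mul_mk, Prod.mk_mul_mk, SemidirectProduct.inl_left_mul_inr_right, one_mul, one_mul,
      mul_one]
  rw [tensorHom_apply, hg, map_mul, map_mul, hleft, hright, one_mul, ← hg]
  rfl

/-- The effect of a Morita auto-equivalence on the linear characters `θ ⊗ χ_i`, and the central
elements that witness it. -/
theorem exists_image_tensorHom [IsDomain O] [IsPrincipalIdealRing O] [CharZero O] [Finite P]
    (hP : IsPGroup 2 P) (hn : 1 ≤ n) {ω : O}
    (hω : ω ^ 2 + ω + 1 = 0) (hω3 : ω ^ 3 = 1)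
    (e : MoritaEquivalence O (MonoidAlgebra O (P × Gn n)) (MonoidAlgebra O (P × Gn n)))
    (I : Equiv.Perm (Irr K (P × Gn n))) (hI : IsInducedBy I e) :
    ∃ (σ : Fin 3 → Fin 3) (J : (P →* O) → (P →* O)),
      (∀ (θ : P →* O) (i : Fin 3) (X : Irr K (P × Gn n)),
        (X : P × Gn n → K) = (fun g => algebraMap O K (tensorHom θ (cubeChar hω3 n i) g)) →
        (I X : P × Gn n → K) =
          fun g => algebraMap O K (tensorHom (J θ) (cubeChar hω3 n (σ i)) g)) ∧
      ∀ x : P, ∃ z ∈ Set.center (MonoidAlgebra O (P × Gn n)), ∀ (θ : P →* O) (i : Fin 3),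
        charHom (tensorHom θ (cubeChar hω3 n i)) z = J θ x := by
  obtain ⟨σ, hσ⟩ := exists_index hω hω3 e hP
  let V (θ : P →* O) (i : Fin 3) := scalarModule.{max w v, v, w}
    (charHom (tensorHom θ (cubeChar hω3 n i)) : MonoidAlgebra O (P × Gn n) →+* O)
  let X (θ : P →* O) (i : Fin 3) : Irr K (P × Gn n) :=
    ⟨((algebraMap O K : O →* K).comp (tensorHom θ (cubeChar hω3 n i)) : P × Gn n →* K),
      coe_mem_Irr _⟩
  have hV (θ : P →* O) (i : Fin 3) : ∃ ψ : P →* O,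
      (∀ (g : P × Gn n) (m : e.eqv.functor.obj (V θ i)), MonoidAlgebra.of O (P × Gn n) g • m =
        tensorHom ψ (cubeChar hω3 n (σ i)) g • m) ∧
      (∀ a b : O, (∀ m : e.eqv.functor.obj (V θ i), a • m = b • m) → a = b) ∧
      (I (X θ i) : P × Gn n → K) =
          fun g => algebraMap O K (tensorHom ψ (cubeChar hω3 n (σ i)) g) := by
    obtain ⟨h1, h2, h3⟩ := latticeChar_scalarModule (K := K) (tensorHom θ (cubeChar hω3 n i))
    obtain ⟨hfin, hfree, hchar⟩ := hI (V θ i) (X θ i) h1 h2 h3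
    obtain ⟨hrank, ψ, hres, hψ⟩ := exists_linear_image e (tensorHom θ (cubeChar hω3 n i))
      ((cubeChar hω3 n (σ i)).comp (MonoidHom.snd P (Gn n))) (hσ θ i).1 (hσ θ i).2 hfin hfree
    have hψ' := eq_tensorHom_cubeChar hω3 hres
    refine ⟨ψ.comp (MonoidHom.inl P (Gn n)), ?_, fun a b hab => ?_, ?_⟩
    · rw [← hψ']
      exact hψ
    · have : Nontrivial (e.eqv.functor.obj (V θ i)) :=
        Module.nontrivial_of_finrank_pos (R := O) (hrank ▸ one_pos)
      obtain ⟨m, hm⟩ := exists_ne (0 : e.eqv.functor.obj (V θ i))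
      exact smul_left_injective O hm (hab m)
    · rw [← hψ', ← hchar]
      exact funext fun g => latticeChar_of_smul _ hrank (hψ g)
  choose J hact hfaith hJ using hV
  -- the central element `x` acts as `J θ i x` on the image of `θ ⊗ χ_i`
  have hz (x : P) : ∃ z ∈ Set.center (MonoidAlgebra O (P × Gn n)), ∀ (θ : P →* O) (i : Fin 3),
      charHom (tensorHom θ (cubeChar hω3 n i)) z = J θ i x := by
    have hx : MonoidAlgebra.of O (P × Gn n) (x, 1) ∈ Set.center (MonoidAlgebra O (P × Gn n)) := by
      rw [Semigroup.mem_center_iff]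
      intro a
      induction a using MonoidAlgebra.induction_on with
      | of g =>
        rw [← map_mul, ← map_mul]
        exact congrArg _ (Prod.ext (mul_comm _ _) ((mul_one _).trans (one_mul _).symm))
      | add a b ha hb => rw [add_mul, mul_add, ha, hb]
      | smul c a ha => rw [smul_mul_assoc, mul_smul_comm, ha]
    obtain ⟨z, hz, hzc⟩ := exists_center_smul_eq e hx
    refine ⟨z, hz, fun θ i => hfaith θ i _ _ fun m => ?_⟩
    rw [← hzc (V θ i) _ (fun y => smul_scalarModule _ z y) m, hact, tensorHom_apply, map_one,
      mul_one]
  have hJ0 (θ : P →* O) (i : Fin 3) : J θ i = J θ 0 := by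
    ext x
    obtain ⟨z, hz, hzJ⟩ := hz x
    obtain ⟨k, hk⟩ := hP x
    refine eq_of_four_dvd_sub (m := k) (by rw [← map_pow, hk, map_one])
      (by rw [← map_pow, hk, map_one]) ?_
    rw [← hzJ, ← hzJ]
    exact four_dvd_lift_sub_lift hn hω3 θ i 0 hz
  refine ⟨σ, fun θ => J θ 0, fun θ i Y hY => ?_, fun x => ?_⟩
  · rw [show Y = X θ i from Subtype.ext hY, hJ, hJ0]
  · obtain ⟨z, hz, hzJ⟩ := hz x
    exact ⟨z, hz, fun θ i => by rw [hzJ, hJ0]⟩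

end Induced

/-! ### Perfect self-isometries of abelian two-groups -/

section PerfectIsometry

variable {O K P : Type*} [CommRing O] [Field K]
  [Algebra O K] [CommGroup P] [Fintype P] {ζ : K}

theorem linearIndependent_Irr (hζ : IsPrimitiveRoot ζ (Nat.card P)) :
    LinearIndependent K (Subtype.val : Irr K P → P → K) := by
  choose l hl using fun χ : Irr K P => exists_eq_coe_of_mem_Irr hζ χ.2
  have hinj : Function.Injective l := fun χ χ' h => Subtype.ext (by rw [hl, hl, h])
  have h := (linearIndependent_monoidHom P K).comp l hinj
  exact (funext hl : (Subtype.val : Irr K P → P → K) = _) ▸ h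

/-- `Irr(P)` as a basis of the space of class functions. -/
noncomputable def irrBasis (hζ : IsPrimitiveRoot ζ (Nat.card P)) :
    Module.Basis (Irr K P) K (CF K P) :=
  (Module.Basis.span (linearIndependent_Irr hζ)).map
    (LinearEquiv.ofEq _ _ (by rw [Subtype.range_coe, CF]))

theorem irrBasis_apply (hζ : IsPrimitiveRoot ζ (Nat.card P)) (χ : Irr K P) :
    (irrBasis hζ χ : P → K) = χ := by
  rw [irrBasis, Module.Basis.map_apply, LinearEquiv.coe_ofEq_apply, Module.Basis.span_apply]

/-- The inner product of class functions as a bilinear form. -/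
noncomputable def charInnerForm (K P : Type*) [Field K] [Group P] [Fintype P] :
    (P → K) →ₗ[K] (P → K) →ₗ[K] K :=
  LinearMap.mk₂ K charInner
    (fun α β γ => by simp [charInner, add_mul, Finset.sum_add_distrib, mul_add])
    (fun c α β => by simp [charInner, Finset.mul_sum, mul_assoc, mul_left_comm])
    (fun α β γ => by simp [charInner, Finset.sum_add_distrib, mul_add])
    (fun c α β => by simp [charInner, Finset.mul_sum, mul_left_comm])

theorem charInner_Irr [CharZero K] (hζ : IsPrimitiveRoot ζ (Nat.card P)) [DecidableEq (Irr K P)]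
    (χ χ' : Irr K P) : charInner (χ : P → K) χ' = if χ = χ' then 1 else 0 := by
  obtain ⟨l, hl⟩ := exists_eq_coe_of_mem_Irr hζ χ.2
  obtain ⟨l', hl'⟩ := exists_eq_coe_of_mem_Irr hζ χ'.2
  have hl0 (g : P) : l' g * l' g⁻¹ = 1 := by rw [← map_mul, mul_inv_cancel, map_one]
  let f : P →* K := ⟨⟨fun g => l g * l' g⁻¹, by simp⟩, fun g h => by
    simp only [map_mul, mul_inv]
    ring⟩
  have hf : charInner (χ : P → K) χ' = (Fintype.card P : K)⁻¹ * ∑ g, f g := by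
    rw [charInner, hl, hl']
    rfl
  rw [hf]
  split_ifs with h
  · have h1 (g : P) : f g = 1 := by
      have : (l : P → K) = l' := by rw [← hl, h, hl']
      exact (congrArg (· * l' g⁻¹) (congrFun this g)).trans (hl0 g)
    rw [Finset.sum_congr rfl fun g _ => h1 g, Finset.sum_const, Finset.card_univ, nsmul_one,
      inv_mul_cancel₀ (Nat.cast_ne_zero.2 Fintype.card_ne_zero)]
  · rw [sum_hom_units_eq_zero, mul_zero]
    intro h1
    refine h (Subtype.ext ?_)
    rw [hl, hl']
    ext g
    have h2 : l g * l' g⁻¹ = 1 := DFunLike.congr_fun h1 g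
    linear_combination l' g * h2 - l g * hl0 g

/-- The sum of the irreducible characters vanishes away from the identity. -/
theorem sum_Irr_apply_eq_zero (hζ : IsPrimitiveRoot ζ (Nat.card P)) [Fintype (Irr K P)] {x : P}
    (hx : x ≠ 1) : ∑ χ : Irr K P, (χ : P → K) x = 0 := by
  have : NeZero (Nat.card P) := ⟨Nat.card_pos.ne'⟩
  have : HasEnoughRootsOfUnity K (Nat.card P) := ⟨⟨ζ, hζ⟩, inferInstance⟩
  have : HasEnoughRootsOfUnity K (Monoid.exponent P) :=
    HasEnoughRootsOfUnity.of_dvd K (Group.exponent_dvd_nat_card)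
  obtain ⟨l, hl⟩ := CommGroup.exists_apply_ne_one_of_hasEnoughRootsOfUnity P K hx
  -- multiplication by a character that is nontrivial at `x` permutes the summands
  have hmem (l : P →* Kˣ) (χ : Irr K P) :
      (fun y => (l y : K) * (χ : P → K) y) ∈ Irr K P := by
    obtain ⟨l', hl'⟩ := exists_eq_coe_of_mem_Irr hζ χ.2
    rw [hl']
    exact coe_mem_Irr (((Units.coeHom K).comp l) * l')
  let τ : Equiv.Perm (Irr K P) :=
    { toFun := fun χ => ⟨_, hmem l χ⟩
      invFun := fun χ => ⟨_, hmem l⁻¹ χ⟩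
      left_inv := fun χ => Subtype.ext (funext fun y => by simp)
      right_inv := fun χ => Subtype.ext (funext fun y => by simp) }
  have h : ∑ χ : Irr K P, (χ : P → K) x = l x * ∑ χ : Irr K P, (χ : P → K) x := by
    rw [Finset.mul_sum]
    exact (Equiv.sum_comp τ fun χ : Irr K P => (χ : P → K) x).symm
  have h1 : ((l x : K) - 1) * ∑ χ : Irr K P, (χ : P → K) x = 0 := by linear_combination -h
  refine (mul_eq_zero.1 h1).resolve_left fun h2 => hl ?_
  exact Units.ext (sub_eq_zero.1 h2)

/-- A linear automorphism of finite order maps a submodule onto itself once it maps it into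
itself. -/
theorem map_eq_of_map_le {R M : Type*} [Semiring R] [AddCommMonoid M] [Module R M] (f : M →ₗ[R] M)
    {m : ℕ} (hm : 0 < m) (hf : f ^ m = 1) {N : Submodule R M} (hN : ∀ v ∈ N, f v ∈ N) :
    N.map f = N := by
  have hpow (k : ℕ) (v : M) (hv : v ∈ N) : (f ^ k) v ∈ N := by
    induction k with
    | zero => exact hv
    | succ k ih => rw [pow_succ', Module.End.mul_apply]; exact hN _ ih
  refine le_antisymm (Submodule.map_le_iff_le_comap.2 hN) fun v hv => ?_
  refine ⟨(f ^ (m - 1)) v, hpow _ v hv, ?_⟩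
  rw [← Module.End.mul_apply, ← pow_succ', Nat.sub_add_cancel hm, hf, Module.End.one_apply]

/-- A permutation `j` of `Irr(P)` extends to a perfect self-isometry of `𝒪P` if for every `x` there
is an element of `𝒪P` at which each `χ` has the value `j χ x`: then the linear extension of `j`
preserves integrality. The condition on functions vanishing off the `2`-regular
elements is automatic: for a `2`-group these are the multiples of the sum of all characters. -/
theorem exists_isPerfectSelfIsometry [CharZero K] (hP : IsPGroup 2 P)
    (hζ : IsPrimitiveRoot ζ (Nat.card P))
    (j : Equiv.Perm (Irr K P))
    (hj : ∀ x : P, ∃ a : P → O, ∀ χ : Irr K P,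
      (j χ : P → K) x = ∑ y, algebraMap O K (a y) * (χ : P → K) y) :
    ∃ J : ZIrr K P ≃+ ZIrr K P, IsPerfectSelfIsometry O 2 J ∧
      ∀ χ : Irr K P, (J (irrToZIrr χ) : P → K) = j χ := by
  classical
  let b := irrBasis (P := P) hζ
  have hb (χ : Irr K P) : (b χ : P → K) = χ := irrBasis_apply hζ χ
  have : Fintype (Irr K P) := b.fintypeIndexOfRankLtAleph0 (Module.rank_lt_aleph0 K (CF K P))
  let JK : CF K P ≃ₗ[K] CF K P := b.equiv b j
  have hJK (χ : Irr K P) : JK (b χ) = b (j χ) := b.equiv_apply χ b j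
  have hJKsymm (χ : Irr K P) : JK.symm (b χ) = b (j.symm χ) := by
    rw [LinearEquiv.symm_apply_eq, hJK, Equiv.apply_symm_apply]
  have hle {α : P → K} (hα : α ∈ ZIrr K P) : α ∈ CF K P :=
    (AddSubgroup.closure_le (K := (CF K P).toAddSubgroup)).2 Submodule.subset_span hα
  -- a linear map that permutes `Irr(P)` preserves generalized characters
  have hZ (L : CF K P ≃ₗ[K] CF K P) (τ : Irr K P → Irr K P) (hL : ∀ χ, L (b χ) = b (τ χ))
      {α : P → K} (hα : α ∈ ZIrr K P) : (L ⟨α, hle hα⟩ : P → K) ∈ ZIrr K P := by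
    induction hα using AddSubgroup.closure_induction with
    | mem χ hχ =>
      have h : (⟨χ, hle (AddSubgroup.subset_closure hχ)⟩ : CF K P) = b ⟨χ, hχ⟩ :=
        Subtype.ext (hb ⟨χ, hχ⟩).symm
      rw [h, hL, hb]
      exact AddSubgroup.subset_closure (τ _).2
    | zero =>
      have h : (⟨0, hle (zero_mem _)⟩ : CF K P) = 0 := rfl
      rw [h, map_zero]
      exact zero_mem _
    | add α β hα hβ h1 h2 =>
      have h : (⟨α + β, hle (add_mem hα hβ)⟩ : CF K P) = ⟨α, hle hα⟩ + ⟨β, hle hβ⟩ := rfl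
      rw [h, map_add]
      exact add_mem h1 h2
    | neg α hα h1 =>
      have h : (⟨-α, hle (neg_mem hα)⟩ : CF K P) = -⟨α, hle hα⟩ := rfl
      rw [h, map_neg]
      exact neg_mem h1
  let J : ZIrr K P ≃+ ZIrr K P :=
    { toFun := fun α => ⟨_, hZ JK j hJK α.2⟩
      invFun := fun α => ⟨_, hZ JK.symm j.symm hJKsymm α.2⟩
      left_inv := fun α => Subtype.ext (congrArg (Subtype.val : CF K P → P → K)
        (JK.symm_apply_apply ⟨_, hle α.2⟩))
      right_inv := fun α => Subtype.ext (congrArg (Subtype.val : CF K P → P → K)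
        (JK.apply_symm_apply ⟨_, hle α.2⟩))
      map_add' := fun α β =>
        Subtype.ext (congrArg (Subtype.val : CF K P → P → K)
        (JK.map_add ⟨_, hle α.2⟩ ⟨_, hle β.2⟩)) }
  have hJ (α : ZIrr K P) : (J α : P → K) = JK ⟨α, hle α.2⟩ := rfl
  have hinner (φ ψ : CF K P) :
      charInner (JK φ : P → K) (JK ψ) = charInner (φ : P → K) ψ := by
    let B := (charInnerForm K P).domRestrict₁₂ (CF K P) (CF K P)
    have h : B.compl₁₂ JK.toLinearMap JK.toLinearMap = B := b.ext fun χ => b.ext fun χ' => by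
      change charInner (JK (b χ) : P → K) (JK (b χ')) = charInner (b χ : P → K) (b χ')
      rw [hJK, hJK, hb, hb, hb, hb, charInner_Irr hζ, charInner_Irr hζ]
      simp only [j.injective.eq_iff]
    exact LinearMap.congr_fun₂ h φ ψ
  -- the sum of all characters is fixed, and it is a nonzero multiple of the function `δ₁`
  have hreg {φ : CF K P} (hφ : ∀ g : P, ¬ (orderOf g).Coprime 2 → (φ : P → K) g = 0) :
      JK φ = φ := by
    let r : CF K P := ∑ χ, b χ
    have hr (x : P) : (r : P → K) x = ∑ χ : Irr K P, (χ : P → K) x := by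
      simp only [r, AddSubmonoidClass.coe_finsetSum, Finset.sum_apply, hb]
    have hr1 : (r : P → K) 1 ≠ 0 := by
      have h1 (χ : Irr K P) : (χ : P → K) 1 = 1 := by
        obtain ⟨l, hl⟩ := exists_eq_coe_of_mem_Irr hζ χ.2
        rw [hl, map_one]
      have : Nonempty (Irr K P) := ⟨⟨_, coe_mem_Irr 1⟩⟩
      rw [hr, Finset.sum_congr rfl fun χ _ => h1 χ, Finset.sum_const, nsmul_one]
      exact Nat.cast_ne_zero.2 Fintype.card_ne_zero
    have hφr : φ = ((φ : P → K) 1 / (r : P → K) 1) • r := by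
      refine Subtype.ext (funext fun x => ?_)
      change (φ : P → K) x = (φ : P → K) 1 / (r : P → K) 1 * (r : P → K) x
      by_cases hx : x = 1
      · rw [hx, div_mul_cancel₀ _ hr1]
      · rw [hr x, sum_Irr_apply_eq_zero hζ hx, mul_zero]
        refine hφ x fun hcop => hx ?_
        obtain ⟨k, hk⟩ := hP x
        rw [← orderOf_eq_one_iff]
        exact Nat.eq_one_of_dvd_coprimes (hcop.pow_right k) dvd_rfl (orderOf_dvd_of_pow_eq_one hk)
    have hJr : JK r = r := by
      simp only [r, map_sum, hJK]
      exact Equiv.sum_comp j fun χ => b χ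
    rw [hφr, map_smul, hJr]
  have hint {φ : CF K P} (hφ : φ ∈ CFint O K P) : JK φ ∈ CFint O K P := by
    intro x
    obtain ⟨a, ha⟩ := hj x
    -- evaluation at `x` after `JK` is evaluation at the element `∑ y, a y • y` of `𝒪P`
    have h : ((LinearMap.proj x).comp (CF K P).subtype).comp JK.toLinearMap =
        ∑ y, algebraMap O K (a y) • (LinearMap.proj y).comp (CF K P).subtype :=
      b.ext fun χ => by
        change (JK (b χ) : P → K) x = _
        rw [hJK, hb, ha]
        simp [hb, Algebra.smul_def]
    have h' := LinearMap.congr_fun h φ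
    change (JK φ : P → K) x = _ at h'
    rw [h']
    simp only [LinearMap.sum_apply]
    exact sum_mem fun y _ => mul_mem ⟨a y, rfl⟩ (hφ y)
  have hord : (JK.toLinearMap.restrictScalars O) ^ orderOf j = 1 := by
    have hpow (k : ℕ) : ((JK.toLinearMap ^ k : CF K P →ₗ[K] CF K P)) =
        (b.equiv b (j ^ k)).toLinearMap := by
      refine b.ext fun χ => ?_
      rw [LinearEquiv.coe_coe, Module.Basis.equiv_apply]
      induction k with
      | zero => rfl
      | succ k ih => rw [pow_succ', Module.End.mul_apply, ih, LinearEquiv.coe_coe, hJK, pow_succ',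
          Equiv.Perm.mul_apply]
    have h1 : (JK.toLinearMap ^ orderOf j : CF K P →ₗ[K] CF K P) = 1 := by
      rw [hpow, pow_orderOf_eq_one]
      exact b.ext fun χ => b.equiv_apply χ b 1
    have h2 (k : ℕ) : (JK.toLinearMap.restrictScalars O) ^ k =
        (JK.toLinearMap ^ k).restrictScalars O := by
      induction k with
      | zero => rfl
      | succ k ih => rw [pow_succ, pow_succ, ih]; rfl
    rw [h2, h1]
    rfl
  refine ⟨J, ⟨fun α β => hinner _ _, JK, fun α φ h => ?_, ?_, ?_⟩, fun χ => ?_⟩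
  · rw [hJ]
    exact congrArg (fun ψ => (JK ψ : P → K)) (Subtype.ext h)
  · exact map_eq_of_map_le _ (orderOf_pos j) hord fun φ hφ => hint hφ
  · exact map_eq_of_map_le _ (orderOf_pos j) hord fun φ hφ => by
      change JK φ ∈ _
      rwa [hreg hφ.2]
  · have h : (⟨χ, hle (irrToZIrr χ).2⟩ : CF K P) = b χ := Subtype.ext (hb χ).symm
    rw [hJ]
    exact (congrArg (fun ψ => (JK ψ : P → K)) h).trans (by rw [hJK, hb])

end PerfectIsometry

/-! ### Permutations induced by Morita auto-equivalences -/

/-- Evaluating `θ ⊗ 1` on `𝒪[P × H]` is evaluating `θ` on the image in `𝒪P`. -/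
theorem charHom_tensorHom_one {O P H : Type*} [CommRing O] [Group P] [Group H] [Fintype P]
    [Fintype H] (θ : P →* O) (z : MonoidAlgebra O (P × H)) :
    charHom (tensorHom θ (1 : H →* O)) z = ∑ y, (∑ h, z.coeff (y, h)) * θ y := by
  rw [lift_eq_sum, Fintype.sum_prod_type]
  simp only [tensorHom_apply, MonoidHom.one_apply, mul_one, Finset.sum_mul]

theorem cubeChar_zero {M : Type*} [CommMonoid M] {ω : M} (hω : ω ^ 3 = 1) (n : ℕ) :
    cubeChar hω n 0 = 1 := by
  ext g
  simp [cubeChar_apply]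

end PicardBlocks

open PicardBlocks

theorem proposition3p9
    {O K P : Type*}
    [CommRing O] [IsDomain O] [IsDiscreteValuationRing O]
    [IsAdicComplete (IsLocalRing.maximalIdeal O) O]
    [IsAlgClosed (IsLocalRing.ResidueField O)] [CharP (IsLocalRing.ResidueField O) 2]
    [Field K] [CharZero K] [Algebra O K] [IsFractionRing O K]
    [CommGroup P] [Fintype P] (hP : IsPGroup 2 P)
    (n : ℕ) (hn : 1 ≤ n)
    (hK : ∃ ζ : K, IsPrimitiveRoot ζ (Nat.card (P × PicardBlocks.Gn n)))
    {ω : K} (hω : IsPrimitiveRoot ω 3)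
    (e : MoritaEquivalence O (MonoidAlgebra O (P × PicardBlocks.Gn n))
      (MonoidAlgebra O (P × PicardBlocks.Gn n)))
    (I : Equiv.Perm (PicardBlocks.Irr K (P × PicardBlocks.Gn n)))
    (hI : PicardBlocks.IsInducedBy I e) :
    ∃ (σ : Equiv.Perm (Fin 3)) (J : PicardBlocks.ZIrr K P ≃+ PicardBlocks.ZIrr K P),
      PicardBlocks.IsPerfectSelfIsometry O 2 J ∧
      (∀ θ : PicardBlocks.Irr K P, (J (PicardBlocks.irrToZIrr θ) : P → K) ∈ PicardBlocks.Irr K P) ∧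
      ∀ (θ : PicardBlocks.Irr K P) (i : Fin 3),
        (I (PicardBlocks.Irr.tensor θ (PicardBlocks.linChar hω n i)) :
            P × PicardBlocks.Gn n → K) =
          PicardBlocks.tensorFun (J (PicardBlocks.irrToZIrr θ) : P → K)
            (PicardBlocks.linChar hω n (σ i)) := by
  have hinj := IsFractionRing.injective O K
  have : CharZero O := ⟨fun a b h => Nat.cast_injective (R := K) (by
    simpa using congrArg (algebraMap O K) h)⟩
  have := Fintype.ofFinite (Gn n)
  obtain ⟨ζ, hζ⟩ := hK
  rw [Nat.card_prod, mul_comm] at hζ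
  replace hζ := hζ.pow (Nat.mul_pos Nat.card_pos Nat.card_pos) rfl
  obtain ⟨w, hw⟩ : ∃ w : O, algebraMap O K w = ω :=
    IsIntegrallyClosed.algebraMap_eq_of_integral
      (IsIntegral.of_pow (n := 3) (by norm_num) (hω.pow_eq_one ▸ isIntegral_one))
  have hw3 : w ^ 3 = 1 := hinj (by rw [map_pow, hw, map_one, hω.pow_eq_one])
  have hw2 : w ^ 2 + w + 1 = 0 := hinj (by
    rw [map_add, map_add, map_pow, hw, map_one, map_zero]
    have h : (ω - 1) * (ω ^ 2 + ω + 1) = 0 := by linear_combination hω.pow_eq_one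
    exact (mul_eq_zero.1 h).resolve_left (sub_ne_zero.2 (hω.ne_one (by norm_num))))
  have hlin (i : Fin 3) (g : Gn n) : algebraMap O K (cubeChar hw3 n i g) = linChar hω n i g := by
    rw [cubeChar_apply, map_pow, map_pow, hw]
    rfl
  obtain ⟨σ, J₀, hIJ, hz⟩ := exists_image_tensorHom (K := K) hP hn hw2 hw3 e I hI
  let E : (P →* O) ≃ Irr K P := irrEquiv hζ
  have hE (θ : P →* O) (x : P) : (E θ : P → K) x = algebraMap O K (θ x) := rfl
  have hIE (θ : P →* O) (i : Fin 3) :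
      (I (Irr.tensor (E θ) (linChar hω n i)) : P × Gn n → K) =
        tensorFun (E (J₀ θ) : P → K) (linChar hω n (σ i)) := by
    rw [hIJ θ i _ (funext fun g => ?_)]
    · funext g
      rw [tensorHom_apply, map_mul, hlin]
      rfl
    · rw [tensorHom_apply, map_mul, hlin]
      rfl
  -- a function `θ ⊗ χ_i` determines `θ` and `i`, so `σ` and `J₀` inherit injectivity from `I`
  have hdet {θ θ' : P →* O} {i i' : Fin 3} (h : Irr.tensor (E θ) (linChar hω n i) =
      Irr.tensor (E θ') (linChar hω n i')) : θ = θ' ∧ i = i' := by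
    have h (x : P) (g : Gn n) : algebraMap O K (θ x) * linChar hω n i g =
      algebraMap O K (θ' x) * linChar hω n i' g := congrFun (congrArg Subtype.val h) (x, g)
    refine ⟨MonoidHom.ext fun x => hinj (by simpa using h x 1), ?_⟩
    have h1 := h 1 (SemidirectProduct.inr (Multiplicative.ofAdd 1))
    simp only [map_one θ, map_one θ', map_one (algebraMap O K), one_mul] at h1
    have hval (i : Fin 3) :
        linChar hω n i (SemidirectProduct.inr (Multiplicative.ofAdd 1)) = ω ^ (i : ℕ) :=
      pow_one _
    rw [hval, hval] at h1
    exact Fin.ext (hω.pow_inj i.2 i'.2 h1)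
  have hσ : Function.Injective σ := fun i i' h => by
    refine (hdet (θ := 1) (θ' := 1) (I.injective (Subtype.ext ?_))).2
    rw [hIE, hIE, h]
  have hJ₀ : Function.Injective J₀ := fun θ θ' h => by
    refine (hdet (i := 0) (i' := 0) (I.injective (Subtype.ext ?_))).1
    rw [hIE, hIE, h]
  have : Finite (P →* O) := by
    have : Finite (Irr K P) := (linearIndependent_Irr hζ).finite
    exact Finite.of_equiv _ E.symm
  let j : Equiv.Perm (Irr K P) := E.permCongr
    (Equiv.ofBijective J₀ (Finite.injective_iff_bijective.1 hJ₀))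
  have hj (θ : P →* O) : j (E θ) = E (J₀ θ) := by
    simp only [j, Equiv.permCongr_apply, Equiv.symm_apply_apply, Equiv.ofBijective_apply]
  obtain ⟨J, hJ, hJj⟩ := exists_isPerfectSelfIsometry (O := O) hP hζ j fun x => by
    obtain ⟨z, -, hz⟩ := hz x
    refine ⟨fun y => ∑ h, z.coeff (y, h), fun χ => ?_⟩
    obtain ⟨θ, rfl⟩ := E.surjective χ
    rw [hj, hE, ← hz θ 0, cubeChar_zero, charHom_tensorHom_one, map_sum]
    simp only [map_mul, hE]
  refine ⟨Equiv.ofBijective σ (Finite.injective_iff_bijective.1 hσ), J, hJ, fun θ => ?_,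
    fun θ i => ?_⟩
  · rw [hJj]
    exact (j θ).2
  · obtain ⟨θ, rfl⟩ := E.surjective θ
    rw [hIE, hJj, hj]
    rfl
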